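/- A \emph{probability system} is a triple $(X,\mu,T)$ where $(X,\mu)$ is a probability space and $T\colon X\to X$ is an invertible, bimeasurable, measure-preserving map. For $P_1,\dots,P_k\in\mathbb Z[\mathrm n]$, measurable $f_1,\dots,f_k\colon X\to\mathbb C$ and real $N\ge 1$ put $$A_N^{P_1,\dots,P_k}(f_1,\dots,f_k)(x)=\frac1{\lfloor N\rfloor}\sum_{n=1}^{\lfloor N\rfloor} f_1(T^{P_1(n)}x)\cdots f_k(T^{P_k(n)}x).$$ For $r>0$, a set $\mathbb I\subseteq\mathbb R$ and complex numbers $(a_t)_{t\in\mathbb I}$ put $$\|(a_t)_{t\in\mathbb I}\|_{V^r}=\sup_{J\ge 1}\ \sup_{t_0\le\dots\le t_J,\ t_j\in\mathbb I}\Big(\sum_{j=0}^{J-1}|a_{t_{j+1}}-a_{t_j}|^r\Big)^{1/r}\in[0,\infty],\qquad \|(a_t)_{t\in\mathbb I}\|_{\mathbf V^r}=\sup_{t\in\mathbb I}|a_t|+\|(a_t)_{t\in\mathbb I}\|_{V^r},$$ and let $\|\cdot\|_{L^p(X;V^r)}$ (resp. $\|\cdot\|_{L^p(X;\mathbf V^r)}$)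 be the $L^p(X)$ norm of $x\mapsto \|(a_t(x))_{t\in\mathbb I}\|_{V^r}$ (resp. $\|(a_t(x))_{t\in\mathbb I}\|_{\mathbf V^r}$), with the value $+\infty$ allowed. \textbf{(Failure of the variational estimate for $r\le 2$.)} Let $P_1,\dots,P_k\in\mathbb Z[\mathrm n]$ be polynomials, not all constant, let $0<p_1,\dots,p_k,p\le\infty$ and $0<r\le 2$, and let $\mathbb I\subseteq\{1,2,3,\dots\}$ be an infinite set. Then there is no constant $C>0$ such that $$\|(A_N^{P_1,\dots,P_k}(f_1,\dots,f_k))_{N\in\mathbb I}\|_{L^p(X;V^r)}\le C\,\|f_1\|_{L^{p_1}(X)}\cdots\|f_k\|_{L^{p_k}(X)}$$ for all probability systems $(X,\mu,T)$ and all $f_1\in L^{p_1}(X),\dots,f_k\in L^{p_k}(X)$. \textbf{(Sharpness of $r>2$ in the bilinear long variational ergodic theorem.)} In particular, let $P\in\mathbb Z[\mathrm n]$ have degree at least $2$, let $1<p_1,p_2<\infty$ with $\frac1{p_1}+\frac1{p_2}=\frac1p\le 1$, let $\lambda>1$, let $1\le N_1<N_2<\cdots$ be real numbers with $N_{j+1}/N_j>\lambda$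 for all $j$, put $\mathbb D=\{N_1,N_2,\dots\}$, and let $0<r\le 2$. Then there is no constant $C>0$ such that $$\|(A_N^{\mathrm n,P(\mathrm n)}(f,g))_{N\in\mathbb D}\|_{L^p(X;\mathbf V^r)}\le C\,\|f\|_{L^{p_1}(X)}\|g\|_{L^{p_2}(X)}$$ for all probability systems $(X,\mu,T)$ and all $f\in L^{p_1}(X)$, $g\in L^{p_2}(X)$. -/

import Mathlib

open MeasureTheory
open scoped ENNReal

/-- The non-conventional polynomial ergodic average
`A_N (f₁, …, f_k) (x) = ⌊N⌋⁻¹ ∑_{1 ≤ n ≤ ⌊N⌋} f₁ (T ^ P₁(n) x) ⋯ f_k (T ^ P_k(n) x)`, for a real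
number `N ≥ 1`. The powers of the invertible map `T` are powers with integer exponents in the group
of permutations of `X`. -/
noncomputable def polyErgodicAverage {X : Type*} [MeasurableSpace X] (T : X ≃ᵐ X) {k : ℕ}
    (P : Fin k → Polynomial ℤ) (f : Fin k → X → ℂ) (N : ℝ) (x : X) : ℂ :=
  (⌊N⌋₊ : ℂ)⁻¹ * ∑ n ∈ Finset.Icc 1 ⌊N⌋₊,
    ∏ i, f i (((T.toEquiv : Equiv.Perm X) ^ ((P i).eval (n : ℤ))) x)

/-- The `r`-variation seminorm of `(a t)`, `t ∈ I`: the supremum of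
`(∑_{j < J} |a (t_{j+1}) - a (t_j)| ^ r) ^ (1 / r)` over all `J ≥ 1` and all
`t_0 ≤ ⋯ ≤ t_J` in `I`, as an extended nonnegative real. It is zero when `I` is empty. -/
noncomputable def rVariation {ι : Type*} [LinearOrder ι] (r : ℝ) (I : Set ι) (a : ι → ℂ) : ℝ≥0∞ :=
  ⨆ (J : ℕ) (_ : 1 ≤ J) (t : Fin (J + 1) → ι) (_ : Monotone t) (_ : ∀ j, t j ∈ I),
    (∑ j : Fin J, ‖a (t j.succ) - a (t j.castSucc)‖ₑ ^ r) ^ (1 / r)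

/-- The full `r`-variation norm: the supremum norm plus the `r`-variation seminorm. -/
noncomputable def rVariationNorm {ι : Type*} [LinearOrder ι] (r : ℝ) (I : Set ι) (a : ι → ℂ) :
    ℝ≥0∞ :=
  (⨆ t ∈ I, ‖a t‖ₑ) + rVariation r I a

/-!
A random walk with `J` bounded symmetric steps, scaled by `δ = J ^ (-1 / 2)`, has total variance of
order one, but its 2-variation tends to infinity with `J`: a block of `B` consecutive steps, at any
of the scales `1, B, B², …`, has with probability at least `2 ^ (-B)` increments all of the same
sign, and then it is better to merge them into one increment. Once enough scales are available,
the squared variation of the walk is of order `B`.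

Averages along a polynomial can imitate such a walk. Let `F θ = ∏_{i < J} (1 + i δ cos (2 π θ_i))`
on the infinite torus, and choose the frequencies `α_0, α_1, …` one after the other, together with
lengths `N_0 ≤ N_1 ≤ …`, as follows: `α_j` is so small that the `j`-th coordinate hardly moves
during the first `N_j` steps, and `N_{j + 1}` is so large that, by Weyl's equidistribution theorem,
the coordinates up to the `j`-th are averaged out. Since each factor has mean one, the average of
`F` of length `N_j` is nearly the tail product `∏_{i ≥ j} (1 + i δ cos (2 π θ_i))`, whose increments
in `j` are, to first order and up to a factor of modulus at least one, those of the walk with steps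
`δ cos (2 π θ_i)`.
-/

section WeylSums

open Filter Topology AddCircle

/-- The normalised Weyl sum `N⁻¹ ∑_{1 ≤ n ≤ N} e(P(n) β)`; it is `0` for `N = 0`. -/
noncomputable def weylSum (P : Polynomial ℤ) (N : ℕ) (β : UnitAddCircle) : ℂ :=
  (N : ℂ)⁻¹ * ∑ n ∈ Finset.Icc 1 N, fourier (P.eval (n : ℤ)) β

lemma continuous_weylSum (P : Polynomial ℤ) (N : ℕ) : Continuous (weylSum P N) := by
  unfold weylSum
  fun_prop

lemma integral_fourier (m : ℤ) :
    ∫ t : UnitAddCircle, fourier m t ∂haarAddCircle = if m = 0 then 1 else 0 := by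
  split_ifs with h
  · simp [h]
  · exact integral_eq_zero_of_add_right_eq_neg (μ := haarAddCircle)
      (fourier_add_half_inv_index h zero_lt_one)

lemma card_filter_eval_eq_le {P : Polynomial ℤ} (hP : P.natDegree ≠ 0) (s : Finset ℕ) (c : ℤ) :
    (s.filter fun m : ℕ => P.eval (m : ℤ) = c).card ≤ P.natDegree := by
  have hPc : P - Polynomial.C c ≠ 0 := fun h =>
    hP (by rw [sub_eq_zero.1 h, Polynomial.natDegree_C])
  calc (s.filter fun m : ℕ => P.eval (m : ℤ) = c).card
      ≤ (P - Polynomial.C c).roots.toFinset.card := by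
        refine Finset.card_le_card_of_injOn (fun m : ℕ => (m : ℤ)) (fun m hm => ?_)
          (fun a _ b _ h => Int.ofNat_injective h)
        have := (Finset.mem_filter.1 hm).2
        rw [Finset.mem_coe, Multiset.mem_toFinset, Polynomial.mem_roots hPc]
        simp [this]
    _ ≤ Multiset.card (P - Polynomial.C c).roots := Multiset.toFinset_card_le _
    _ ≤ (P - Polynomial.C c).natDegree := Polynomial.card_roots' _
    _ = P.natDegree := Polynomial.natDegree_sub_C

lemma norm_weylSum_sq (P : Polynomial ℤ) (N : ℕ) (β : UnitAddCircle) :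
    ((‖weylSum P N β‖ ^ 2 : ℝ) : ℂ) = (N : ℂ)⁻¹ ^ 2 * ∑ n ∈ Finset.Icc 1 N,
      ∑ m ∈ Finset.Icc 1 N, fourier (P.eval (m : ℤ) - P.eval (n : ℤ)) β := by
  rw [Complex.ofReal_pow, ← Complex.mul_conj', weylSum, map_mul, map_sum, map_inv₀,
    Complex.conj_natCast]
  simp_rw [← fourier_neg]
  rw [mul_mul_mul_comm, ← sq, Finset.sum_mul_sum, Finset.sum_comm]
  simp_rw [← fourier_add, ← sub_eq_add_neg]

lemma integral_norm_weylSum_sq (P : Polynomial ℤ) (N : ℕ) :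
    ∫ β, ‖weylSum P N β‖ ^ 2 ∂haarAddCircle = (N : ℝ)⁻¹ ^ 2 * ∑ n ∈ Finset.Icc 1 N,
      (((Finset.Icc 1 N).filter fun m : ℕ => P.eval (m : ℤ) = P.eval (n : ℤ)).card : ℝ) := by
  have hint (m : ℤ) : Integrable (fun t : UnitAddCircle => fourier m t) haarAddCircle :=
    (fourier m).continuous.integrable_of_hasCompactSupport (.of_compactSpace _)
  apply Complex.ofReal_injective
  rw [← integral_complex_ofReal]
  simp_rw [norm_weylSum_sq]
  rw [integral_const_mul, integral_finsetSum _ fun n _ => integrable_finsetSum _ fun m _ => hint _]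
  simp_rw [integral_finsetSum _ fun _ _ => hint _, integral_fourier, sub_eq_zero, Finset.sum_boole]
  push_cast
  rfl

lemma integral_norm_weylSum_sq_le {P : Polynomial ℤ} (hP : P.natDegree ≠ 0) (N : ℕ) :
    ∫ β, ‖weylSum P N β‖ ^ 2 ∂haarAddCircle ≤ P.natDegree / N := by
  rw [integral_norm_weylSum_sq]
  calc _ ≤ (N : ℝ)⁻¹ ^ 2 * ∑ _ ∈ Finset.Icc 1 N, (P.natDegree : ℝ) := by
        gcongr
        exact card_filter_eval_eq_le hP _ _
    _ = P.natDegree / N := by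
        rcases eq_or_ne N 0 with rfl | hN
        · simp
        · simp only [Finset.sum_const, Nat.card_Icc, add_tsub_cancel_right, nsmul_eq_mul]
          field_simp

lemma exists_subseq_weylSum_tendsto_zero_ae {P : Polynomial ℤ} (hP : P.natDegree ≠ 0)
    {L : ℕ → ℕ} (hL : Tendsto L atTop atTop) :
    ∃ φ : ℕ → ℕ, StrictMono φ ∧ ∀ᵐ β ∂(haarAddCircle (T := (1 : ℝ))),
      Tendsto (fun n => weylSum P (L (φ n)) β) atTop (𝓝 0) := by
  have hbound (n : ℕ) : eLpNorm (weylSum P (L n) - fun _ => 0) 2 (haarAddCircle (T := (1 : ℝ))) ≤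
      ENNReal.ofReal ((P.natDegree / (L n : ℝ)) ^ (2⁻¹ : ℝ)) := by
    have hmem : MemLp (weylSum P (L n)) 2 (haarAddCircle (T := (1 : ℝ))) :=
      (continuous_weylSum P _).memLp_of_hasCompactSupport (.of_compactSpace _)
    rw [← Pi.zero_def, sub_zero,
      hmem.eLpNorm_eq_integral_rpow_norm two_ne_zero ENNReal.ofNat_ne_top]
    simp only [ENNReal.toReal_ofNat, Real.rpow_ofNat]
    gcongr
    exact integral_norm_weylSum_sq_le hP (L n)
  have hzero : Tendsto (fun n => ENNReal.ofReal ((P.natDegree / (L n : ℝ)) ^ (2⁻¹ : ℝ)))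
      atTop (𝓝 0) := by
    have := ((tendsto_const_nhds (x := (P.natDegree : ℝ))).div_atTop
      (tendsto_natCast_atTop_atTop.comp hL)).rpow_const (p := 2⁻¹) (Or.inr (by norm_num))
    simpa using ENNReal.tendsto_ofReal this
  exact (tendstoInMeasure_of_tendsto_eLpNorm two_ne_zero
    (fun n => (continuous_weylSum P _).aestronglyMeasurable) aestronglyMeasurable_const
    (tendsto_of_tendsto_of_tendsto_of_le_of_le tendsto_const_nhds hzero (fun _ => zero_le)
      hbound)).exists_seq_tendsto_ae

end WeylSums

section Equidistribution

open Filter Topology AddCircle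

/-- The average of `f` over the points `P(n) α + θ`, `1 ≤ n ≤ N`, of the orbit of `θ` under the
rotation by `α`. -/
noncomputable def orbitAverage {G : Type*} [AddCommGroup G] (P : Polynomial ℤ) (α : G) (N : ℕ)
    (f : G → ℂ) (θ : G) : ℂ :=
  (N : ℂ)⁻¹ * ∑ n ∈ Finset.Icc 1 N, f (P.eval (n : ℤ) • α + θ)

lemma norm_inv_natCast_mul_sum_le {N : ℕ} {u : ℕ → ℂ} {C : ℝ} (hC : 0 ≤ C)
    (hu : ∀ n ∈ Finset.Icc 1 N, ‖u n‖ ≤ C) : ‖(N : ℂ)⁻¹ * ∑ n ∈ Finset.Icc 1 N, u n‖ ≤ C := by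
  have hsum : ‖∑ n ∈ Finset.Icc 1 N, u n‖ ≤ N * C := by
    simpa using norm_sum_le_of_le _ hu
  calc ‖(N : ℂ)⁻¹ * ∑ n ∈ Finset.Icc 1 N, u n‖ ≤ (N : ℝ)⁻¹ * (N * C) := by
        rw [norm_mul, norm_inv, Complex.norm_natCast]
        gcongr
    _ = (N : ℝ)⁻¹ * N * C := by ring
    _ ≤ C := mul_le_of_le_one_left hC inv_mul_le_one

section Basic

variable {G : Type*} [AddCommGroup G] (P : Polynomial ℤ) (α : G) (N : ℕ)

lemma norm_orbitAverage_le {f : G → ℂ} {C : ℝ} (hf : ∀ θ, ‖f θ‖ ≤ C) (θ : G) :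
    ‖orbitAverage P α N f θ‖ ≤ C :=
  norm_inv_natCast_mul_sum_le ((norm_nonneg _).trans (hf 0)) fun _ _ => hf _

lemma orbitAverage_add (f g : G → ℂ) (θ : G) :
    orbitAverage P α N (f + g) θ = orbitAverage P α N f θ + orbitAverage P α N g θ := by
  simp only [orbitAverage, Pi.add_apply, Finset.sum_add_distrib, mul_add]

lemma orbitAverage_sub (f g : G → ℂ) (θ : G) :
    orbitAverage P α N (f - g) θ = orbitAverage P α N f θ - orbitAverage P α N g θ := by
  simp only [orbitAverage, Pi.sub_apply, Finset.sum_sub_distrib, mul_sub]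

lemma orbitAverage_smul (c : ℂ) (f : G → ℂ) (θ : G) :
    orbitAverage P α N (c • f) θ = c * orbitAverage P α N f θ := by
  simp only [orbitAverage, Pi.smul_apply, smul_eq_mul, ← Finset.mul_sum, mul_left_comm]

end Basic

variable {d : Type*} [Fintype d]

/-- The product of the normalised Haar measures on the torus indexed by `d`. -/
noncomputable abbrev torusMeasure (d : Type*) [Fintype d] : Measure (UnitAddTorus d) :=
  Measure.pi fun _ => haarAddCircle

lemma orbitAverage_mFourier (P : Polynomial ℤ) (α : UnitAddTorus d) (N : ℕ) (m : d → ℤ)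
    (θ : UnitAddTorus d) :
    orbitAverage P α N (UnitAddTorus.mFourier m) θ =
      weylSum P N (∑ i, m i • α i) * UnitAddTorus.mFourier m θ := by
  have hchar (z : ℤ) : UnitAddTorus.mFourier m (z • α) = fourier z (∑ i, m i • α i) := by
    have htoCircle : toCircle (∑ i, z • m i • α i) = ∏ i, toCircle (z • m i • α i) :=
      map_prod toCircle_addChar.toMonoidHom
        (fun i => Multiplicative.ofAdd (z • m i • α i)) Finset.univ
    simp only [UnitAddTorus.mFourier, ContinuousMap.coe_mk, fourier_apply, Pi.smul_apply,
      Finset.smul_sum, smul_comm _ z, htoCircle]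
    exact (map_prod Circle.coeHom _ _).symm
  have hterm (z : ℤ) : UnitAddTorus.mFourier m (z • α + θ) =
      fourier z (∑ i, m i • α i) * UnitAddTorus.mFourier m θ := by
    rw [← hchar]
    simp only [UnitAddTorus.mFourier, ContinuousMap.coe_mk, fourier_apply, Pi.add_apply, smul_add,
      toCircle_add, Circle.coe_mul, Finset.prod_mul_distrib]
  simp_rw [orbitAverage, hterm, ← Finset.sum_mul, weylSum, mul_assoc]

lemma integral_mFourier (m : d → ℤ) :
    ∫ θ, UnitAddTorus.mFourier m θ ∂torusMeasure d = if m = 0 then 1 else 0 := by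
  simp only [UnitAddTorus.mFourier, ContinuousMap.coe_mk, torusMeasure]
  rw [integral_fintype_prod_eq_prod (f := fun i => fourier (m i))]
  simp_rw [integral_fourier]
  simp [Finset.prod_ite_zero, funext_iff]

/-- The frequencies `α` for which the orbits `(P(n) α)` equidistribute in the torus along the
lengths `L`, by Weyl's criterion. -/
def IsWeylGeneric (P : Polynomial ℤ) (L : ℕ → ℕ) (α : UnitAddTorus d) : Prop :=
  ∀ m : d → ℤ, m ≠ 0 → Tendsto (fun n => weylSum P (L n) (∑ i, m i • α i)) atTop (𝓝 0)

variable {P : Polynomial ℤ} {L : ℕ → ℕ} {α : UnitAddTorus d}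

lemma integrable_torusMeasure (f : C(UnitAddTorus d, ℂ)) : Integrable f (torusMeasure d) :=
  f.continuous.integrable_of_hasCompactSupport (.of_compactSpace _)

lemma IsWeylGeneric.tendstoUniformly_mFourier (hα : IsWeylGeneric P L α)
    (hL : ∀ᶠ n in atTop, L n ≠ 0) (m : d → ℤ) :
    TendstoUniformly (fun n => orbitAverage P α (L n) (UnitAddTorus.mFourier m))
      (fun _ => ∫ θ, UnitAddTorus.mFourier m θ ∂torusMeasure d) atTop := by
  simp_rw [funext (orbitAverage_mFourier P α _ m), integral_mFourier, Metric.tendstoUniformly_iff]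
  intro ε hε
  rcases eq_or_ne m 0 with rfl | hm
  · filter_upwards [hL] with n hn θ
    simpa [weylSum, UnitAddTorus.mFourier_zero, hn] using hε
  · filter_upwards [Metric.tendsto_nhds.1 (hα m hm) ε hε] with n hn θ
    have hle : ‖UnitAddTorus.mFourier m θ‖ ≤ 1 :=
      ((UnitAddTorus.mFourier m).norm_coe_le_norm θ).trans_eq UnitAddTorus.mFourier_norm
    rw [dist_zero_right] at hn
    rw [if_neg hm, dist_zero_left, norm_mul]
    exact (mul_le_of_le_one_right (norm_nonneg _) hle).trans_lt hn

lemma IsWeylGeneric.tendstoUniformly_of_mem_span (hα : IsWeylGeneric P L α)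
    (hL : ∀ᶠ n in atTop, L n ≠ 0) {f : C(UnitAddTorus d, ℂ)}
    (hf : f ∈ Submodule.span ℂ (Set.range UnitAddTorus.mFourier)) :
    TendstoUniformly (fun n => orbitAverage P α (L n) f)
      (fun _ => ∫ θ, f θ ∂torusMeasure d) atTop := by
  induction hf using Submodule.span_induction with
  | mem f hf =>
    obtain ⟨m, rfl⟩ := hf
    exact hα.tendstoUniformly_mFourier hL m
  | zero => simp +contextual [orbitAverage, Metric.tendstoUniformly_iff]
  | add f g _ _ hf hg =>
    convert hf.add hg using 1
    · ext n θ
      exact orbitAverage_add P α (L n) f g θ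
    · ext
      exact integral_add (integrable_torusMeasure f) (integrable_torusMeasure g)
  | smul c f _ hf =>
    convert (uniformContinuous_const_smul c).comp_tendstoUniformly hf using 1
    · ext n θ
      exact orbitAverage_smul P α (L n) c f θ
    · ext
      exact integral_const_mul c f

theorem IsWeylGeneric.tendstoUniformly (hα : IsWeylGeneric P L α)
    (hL : ∀ᶠ n in atTop, L n ≠ 0) (f : C(UnitAddTorus d, ℂ)) :
    TendstoUniformly (fun n => orbitAverage P α (L n) f)
      (fun _ => ∫ θ, f θ ∂torusMeasure d) atTop := by
  rw [Metric.tendstoUniformly_iff]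
  intro ε hε
  obtain ⟨g, hg, hfg⟩ : ∃ g ∈ Submodule.span ℂ (Set.range UnitAddTorus.mFourier),
      dist f g < ε / 3 := by
    have : f ∈ (Submodule.span ℂ (Set.range UnitAddTorus.mFourier)).topologicalClosure := by
      simp [UnitAddTorus.span_mFourier_closure_eq_top]
    exact Metric.mem_closure_iff.1 this (ε / 3) (by positivity)
  have hsub (θ : UnitAddTorus d) : ‖(f - g) θ‖ ≤ dist f g :=
    ((f - g).norm_coe_le_norm θ).trans_eq (dist_eq_norm f g).symm
  have hint : dist (∫ θ, f θ ∂torusMeasure d) (∫ θ, g θ ∂torusMeasure d) ≤ dist f g := by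
    rw [dist_eq_norm, ← integral_sub (integrable_torusMeasure f) (integrable_torusMeasure g)]
    simpa using norm_integral_le_of_norm_le_const (μ := torusMeasure d) (.of_forall hsub)
  filter_upwards [Metric.tendstoUniformly_iff.1 (hα.tendstoUniformly_of_mem_span hL hg) (ε / 3)
    (by positivity)] with n hn θ
  have havg : dist (orbitAverage P α (L n) g θ) (orbitAverage P α (L n) f θ) ≤ dist f g := by
    rw [dist_comm, dist_eq_norm, ← orbitAverage_sub]
    exact norm_orbitAverage_le P α (L n) hsub θ
  calc _ ≤ _ := dist_triangle4 _ (∫ θ, g θ ∂torusMeasure d) (orbitAverage P α (L n) g θ) _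
    _ < ε / 3 + ε / 3 + ε / 3 := by linarith [hn θ]
    _ = ε := by ring

end Equidistribution

section Frequencies

open Filter Topology AddCircle

/-- The function `θ ↦ ∏_{i ∈ s} h (θ i)` on the infinite torus. -/
noncomputable def coordProd (h : UnitAddCircle → ℂ) (s : Finset ℕ) (θ : UnitAddTorus ℕ) : ℂ :=
  ∏ i ∈ s, h (θ i)

lemma norm_coordProd_le_pow {h : UnitAddCircle → ℂ} {K : ℝ} (hK : ∀ t, ‖h t‖ ≤ K) (s : Finset ℕ)
    (θ : UnitAddTorus ℕ) : ‖coordProd h s θ‖ ≤ K ^ s.card := by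
  rw [coordProd, norm_prod]
  exact (Finset.prod_le_prod (fun i _ => norm_nonneg _) fun i _ => hK (θ i)).trans_eq
    (Finset.prod_const K)

lemma eventually_forall_norm_zsmul_add_sub_le {G : Type*} [SeminormedAddCommGroup G] {h : G → ℂ}
    (hh : UniformContinuous h) {η : ℝ} (hη : 0 < η) (z : ℤ) :
    ∀ᶠ a in 𝓝 (0 : G), ∀ t, ‖h (z • a + t) - h t‖ ≤ η := by
  obtain ⟨δ, hδ, hhδ⟩ := Metric.uniformContinuous_iff.1 hh η hη
  have hsmul : Tendsto (fun a : G => z • a) (𝓝 0) (𝓝 0) := by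
    simpa using (continuous_zsmul z).tendsto (0 : G)
  filter_upwards [Metric.tendsto_nhds.1 hsmul δ hδ] with a ha t
  rw [← dist_eq_norm]
  exact (hhδ (by simpa using ha)).le

variable {P : Polynomial ℤ} {L : ℕ → ℕ} {J : ℕ}

lemma IsWeylGeneric.ae_update {α : UnitAddTorus ℕ}
    (hα : IsWeylGeneric P L fun i : Fin J => α i)
    (hL : ∀ᵐ β ∂(haarAddCircle (T := (1 : ℝ))),
      Tendsto (fun n => weylSum P (L n) β) atTop (𝓝 0)) :
    ∀ᵐ a ∂(haarAddCircle (T := (1 : ℝ))),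
      IsWeylGeneric P L fun i : Fin (J + 1) => Function.update α J a i := by
  have hsum (a : UnitAddCircle) (m : Fin (J + 1) → ℤ) :
      ∑ i, m i • Function.update α J a i =
        ∑ i : Fin J, m i.castSucc • α i + m (Fin.last J) • a := by
    simp [Fin.sum_univ_castSucc, Function.update_of_ne, Fin.is_lt, ne_of_lt]
  simp only [IsWeylGeneric, hsum]
  refine ae_all_iff.2 fun m => ?_
  by_cases hlast : m (Fin.last J) = 0
  · refine .of_forall fun a hm => ?_
    have hinit : (fun i : Fin J => m i.castSucc) ≠ 0 := by
      contrapose! hm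
      ext i
      exact Fin.lastCases hlast (congrFun hm) i
    simpa [hlast] using hα _ hinit
  · have hpres := (measurePreserving_add_left (haarAddCircle (T := (1 : ℝ)))
      (∑ i : Fin J, m i.castSucc • α i)).comp (Measure.measurePreserving_zsmul haarAddCircle hlast)
    filter_upwards [hpres.quasiMeasurePreserving.ae hL] with a ha _ using ha

lemma IsWeylGeneric.eventually_norm_orbitAverage_coordProd_sub_one_le {α : UnitAddTorus ℕ}
    (hα : IsWeylGeneric P L fun i : Fin J => α i) (hL : ∀ᶠ n in atTop, L n ≠ 0)
    {h : C(UnitAddCircle, ℂ)} (hint : ∫ t, h t ∂haarAddCircle = 1) {ε : ℝ} (hε : 0 < ε) :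
    ∀ᶠ n in atTop, ∀ θ, ‖orbitAverage P α (L n) (coordProd h (Finset.range J)) θ - 1‖ ≤ ε := by
  let f : C(UnitAddTorus (Fin J), ℂ) := ⟨fun θ => ∏ i, h (θ i), by fun_prop⟩
  have hf : ∫ θ, f θ ∂torusMeasure (Fin J) = 1 := by
    simp [f, torusMeasure, integral_fintype_prod_eq_prod (f := fun _ : Fin J => h), hint]
  filter_upwards [Metric.tendstoUniformly_iff.1 (hα.tendstoUniformly hL f) ε hε] with n hn θ
  have := hn fun i => θ i
  rw [hf, dist_comm, dist_eq_norm] at this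
  simpa [orbitAverage, coordProd, Finset.prod_range, f] using this.le

lemma norm_orbitAverage_coordProd_update_sub_le {h : UnitAddCircle → ℂ} {K η : ℝ}
    (hK : ∀ t, ‖h t‖ ≤ K) (α : UnitAddTorus ℕ) {a : UnitAddCircle} {N : ℕ}
    (ha : ∀ n ∈ Finset.Icc 1 N, ∀ t, ‖h (P.eval (n : ℤ) • a + t) - h t‖ ≤ η)
    (hη : 0 ≤ η) (θ : UnitAddTorus ℕ) :
    ‖orbitAverage P (Function.update α J a) N (coordProd h (Finset.range (J + 1))) θ -
      h (θ J) * orbitAverage P α N (coordProd h (Finset.range J)) θ‖ ≤ K ^ J * η := by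
  have hupdate (z : ℤ) : coordProd h (Finset.range (J + 1)) (z • Function.update α J a + θ) =
      coordProd h (Finset.range J) (z • α + θ) * h (z • a + θ J) := by
    simp only [coordProd, Finset.prod_range_succ, Pi.add_apply, Pi.smul_apply,
      Function.update_self]
    congr 1
    refine Finset.prod_congr rfl fun i hi => ?_
    rw [Function.update_of_ne (Finset.mem_range.1 hi).ne]
  have hprod (θ' : UnitAddTorus ℕ) : ‖coordProd h (Finset.range J) θ'‖ ≤ K ^ J := by
    simpa using norm_coordProd_le_pow hK (Finset.range J) θ'
  have hKJ : 0 ≤ K ^ J := (norm_nonneg _).trans (hprod 0)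
  simp only [orbitAverage, hupdate, mul_left_comm (h (θ J)), ← mul_sub, Finset.mul_sum,
    ← Finset.sum_sub_distrib]
  simp only [← mul_sub, ← Finset.mul_sum, mul_comm (h (θ J))]
  refine norm_inv_natCast_mul_sum_le (mul_nonneg hKJ hη) fun n hn => ?_
  rw [norm_mul]
  exact mul_le_mul (hprod _) (ha n hn _) (norm_nonneg _) hKJ

lemma norm_orbitAverage_coordProd_update_sub_coordProd_le {h : UnitAddCircle → ℂ} {K η ε : ℝ}
    (hK : ∀ t, ‖h t‖ ≤ K) {α : UnitAddTorus ℕ} {a : UnitAddCircle} {N j : ℕ} (hj : j ≤ J)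
    (ha : ∀ n ∈ Finset.Icc 1 N, ∀ t, ‖h (P.eval (n : ℤ) • a + t) - h t‖ ≤ η) (hη : 0 ≤ η)
    {θ : UnitAddTorus ℕ} (hε : ‖orbitAverage P α N (coordProd h (Finset.range J)) θ -
      coordProd h (Finset.Ico j J) θ‖ ≤ ε) :
    ‖orbitAverage P (Function.update α J a) N (coordProd h (Finset.range (J + 1))) θ -
      coordProd h (Finset.Ico j (J + 1)) θ‖ ≤ K ^ J * η + K * ε := by
  have hfactor : coordProd h (Finset.Ico j (J + 1)) θ =
      h (θ J) * coordProd h (Finset.Ico j J) θ := by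
    rw [coordProd, Finset.prod_Ico_succ_top hj, mul_comm, coordProd]
  refine (norm_sub_le_norm_sub_add_norm_sub _
    (h (θ J) * orbitAverage P α N (coordProd h (Finset.range J)) θ) _).trans ?_
  rw [hfactor, ← mul_sub, norm_mul]
  gcongr
  · exact norm_orbitAverage_coordProd_update_sub_le hK α ha hη θ
  · exact (norm_nonneg _).trans (hK 0)
  · exact hK _

theorem exists_frequencies_of_weylSum_tendsto_zero (hL : ∀ᶠ n in atTop, L n ≠ 0)
    (hweyl : ∀ᵐ β ∂(haarAddCircle (T := (1 : ℝ))),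
      Tendsto (fun n => weylSum P (L n) β) atTop (𝓝 0))
    {h : C(UnitAddCircle, ℂ)} (hint : ∫ t, h t ∂haarAddCircle = 1) (J : ℕ) {ε : ℝ} (hε : 0 < ε) :
    ∃ (α : UnitAddTorus ℕ) (N : ℕ → ℕ), Monotone N ∧ IsWeylGeneric P L (fun i : Fin J => α i) ∧
      ∀ j ≤ J, ∀ θ, ‖orbitAverage P α (L (N j)) (coordProd h (Finset.range J)) θ -
        coordProd h (Finset.Ico j J) θ‖ ≤ ε := by
  induction J generalizing ε with
  | zero =>
    obtain ⟨n, hn⟩ := hL.exists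
    refine ⟨0, fun _ => n, monotone_const, fun m hm => absurd (Subsingleton.elim m 0) hm, ?_⟩
    simpa [orbitAverage, coordProd, hn] using hε.le
  | succ J ih =>
    set K : ℝ := ‖h‖ + 1
    have hK (t : UnitAddCircle) : ‖h t‖ ≤ K := (h.norm_coe_le_norm t).trans (by simp [K])
    have hK0 : 0 < K := by positivity
    obtain ⟨α, N, hN, hα, happrox⟩ := ih (ε := ε / (2 * K)) (by positivity)
    set η : ℝ := ε / (2 * K ^ J)
    have hsmall : ∀ᶠ a in 𝓝 (0 : UnitAddCircle), ∀ j ∈ Finset.range (J + 1),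
        ∀ n ∈ Finset.Icc 1 (L (N j)), ∀ t, ‖h (P.eval (n : ℤ) • a + t) - h t‖ ≤ η := by
      simp only [Filter.eventually_all_finset]
      exact fun j _ n _ => eventually_forall_norm_zsmul_add_sub_le
        (CompactSpace.uniformContinuous_of_continuous h.continuous) (by positivity) _
    obtain ⟨a, hgen, hsmall_a⟩ :=
      (Measure.dense_of_ae (hα.ae_update hweyl)).inter_nhds_nonempty hsmall
    obtain ⟨n, hn, hnN⟩ :=
      ((hgen.eventually_norm_orbitAverage_coordProd_sub_one_le hL hint hε).and
        (eventually_ge_atTop (N J))).exists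
    refine ⟨Function.update α J a, fun j => if j ≤ J then N j else n, fun i j hij => ?_, hgen,
      fun j hj θ => ?_⟩
    · dsimp only
      split_ifs with hi hj
      exacts [hN hij, (hN hi).trans hnN, absurd (hij.trans ‹_›) hi, le_rfl]
    · rcases hj.eq_or_lt with rfl | hj
      · simpa [coordProd] using hn θ
      · have hjJ : j ≤ J := Nat.lt_succ_iff.1 hj
        simp only [if_pos hjJ]
        refine (norm_orbitAverage_coordProd_update_sub_coordProd_le hK hjJ
          (hsmall_a j (Finset.mem_range.2 hj)) (by positivity) (happrox j hjJ θ)).trans_eq ?_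
        simp only [η]
        field_simp
        ring

end Frequencies

section AdicVariation

lemma sum_Ico_sum_Ico_mul {M : Type*} [AddCommMonoid M] (n : ℕ) (f : ℕ → M) {p q : ℕ}
    (hpq : p ≤ q) :
    ∑ y ∈ Finset.Ico p q, ∑ j ∈ Finset.Ico (n * y) (n * (y + 1)), f j =
      ∑ j ∈ Finset.Ico (n * p) (n * q), f j := by
  induction q, hpq using Nat.le_induction with
  | base => simp
  | succ q hpq ih =>
    rw [Finset.sum_Ico_succ_top hpq, ih, Finset.sum_Ico_consecutive _ (by gcongr)
      (by gcongr; omega)]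

/-- The largest value of `∑ g s t` over the partitions of the block `[B ^ k * x, B ^ k * (x + 1)]`
into `B`-adic blocks `[s, t]`. -/
noncomputable def adicVariation (B : ℕ) (g : ℕ → ℕ → ℝ) : ℕ → ℕ → ℝ
  | 0, x => g x (x + 1)
  | k + 1, x => max (∑ y ∈ Finset.Ico (B * x) (B * (x + 1)), adicVariation B g k y)
      (g (B ^ (k + 1) * x) (B ^ (k + 1) * (x + 1)))

variable {B : ℕ} {g g' : ℕ → ℕ → ℝ}

lemma adicVariation_zero (x : ℕ) : adicVariation B g 0 x = g x (x + 1) := rfl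

lemma adicVariation_succ (k x : ℕ) : adicVariation B g (k + 1) x =
    max (∑ y ∈ Finset.Ico (B * x) (B * (x + 1)), adicVariation B g k y)
      (g (B ^ (k + 1) * x) (B ^ (k + 1) * (x + 1))) := rfl

lemma mul_adicVariation_sub_le (hB : B ≠ 0) {c e : ℝ} (hc : 0 ≤ c) (he : 0 ≤ e) {k x : ℕ}
    (h : ∀ s t, B ^ k * x ≤ s → s ≤ t → t ≤ B ^ k * (x + 1) → c * g s t - e ≤ g' s t) :
    c * adicVariation B g k x - e * B ^ k ≤ adicVariation B g' k x := by
  induction k generalizing x with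
  | zero => simpa [adicVariation_zero] using h x (x + 1) (by simp) (by simp) (by simp)
  | succ k ih =>
    have hchild : ∀ y ∈ Finset.Ico (B * x) (B * (x + 1)),
        c * adicVariation B g k y - e * B ^ k ≤ adicVariation B g' k y := by
      intro y hy
      rw [Finset.mem_Ico] at hy
      refine ih fun s t hs hst ht => h s t (le_trans ?_ hs) hst (ht.trans ?_)
      · rw [pow_succ, mul_assoc]
        exact Nat.mul_le_mul_left _ hy.1
      · rw [pow_succ, mul_assoc]
        exact Nat.mul_le_mul_left _ hy.2
    have hsum := Finset.sum_le_sum hchild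
    have htop := h (B ^ (k + 1) * x) (B ^ (k + 1) * (x + 1)) le_rfl (by gcongr; omega) le_rfl
    have hone : e ≤ e * B ^ (k + 1) :=
      le_mul_of_one_le_right he (one_le_pow₀ (by exact_mod_cast Nat.one_le_iff_ne_zero.2 hB))
    rw [Finset.sum_sub_distrib, ← Finset.mul_sum, Finset.sum_const, Nat.card_Ico,
      ← Nat.mul_sub, Nat.add_sub_cancel_left, mul_one, nsmul_eq_mul] at hsum
    rw [adicVariation_succ, adicVariation_succ, mul_max_of_nonneg _ _ hc, ← max_sub_sub_right]
    refine max_le_max (hsum.trans' (le_of_eq ?_)) (htop.trans' (by linarith))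
    ring

lemma adicVariation_nonneg (hB : B ≠ 0) (hg : ∀ s t, 0 ≤ g s t) (k x : ℕ) :
    0 ≤ adicVariation B g k x := by
  simpa using mul_adicVariation_sub_le (g := g) (g' := g) (c := 0) (e := 0) (k := k) (x := x) hB
    le_rfl le_rfl (by simp [hg])

lemma adicVariation_congr (hB : B ≠ 0) {k x : ℕ}
    (h : ∀ s t, B ^ k * x ≤ s → s ≤ t → t ≤ B ^ k * (x + 1) → g s t = g' s t) :
    adicVariation B g k x = adicVariation B g' k x := by
  apply le_antisymm
  · simpa using mul_adicVariation_sub_le hB zero_le_one le_rfl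
      fun s t hs hst ht => by simp [h s t hs hst ht]
  · simpa using mul_adicVariation_sub_le hB zero_le_one le_rfl
      fun s t hs hst ht => by simp [h s t hs hst ht]

lemma adicVariation_le (hB : B ≠ 0) {e : ℝ} (he : 0 ≤ e) {k x : ℕ}
    (h : ∀ s t, B ^ k * x ≤ s → s ≤ t → t ≤ B ^ k * (x + 1) → g s t ≤ e) :
    adicVariation B g k x ≤ e * B ^ k := by
  have hzero : ∀ k x, adicVariation B (fun _ _ => 0) k x = 0 := by
    intro k
    induction k with
    | zero => exact fun x => rfl
    | succ k ih => simp [adicVariation_succ, ih]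
  simpa [hzero] using mul_adicVariation_sub_le (g' := fun _ _ => 0) hB zero_le_one he
    fun s t hs hst ht => by simpa using h s t hs hst ht

/-- Collapses every block `[n * x, n * (x + 1))` with `x ∈ S` to its left end point, and agrees with
`φ` on the other blocks. -/
noncomputable def collapseBlocks (n : ℕ) (S : Set ℕ) (φ : ℕ → ℕ) (j : ℕ) : ℕ :=
  open Classical in if j / n ∈ S then n * (j / n) else φ j

section CollapseBlocks

variable {n : ℕ} {S : Set ℕ} {φ : ℕ → ℕ}

lemma collapseBlocks_mul (hn : n ≠ 0) (hfix : ∀ x, φ (n * x) = n * x) (x : ℕ) :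
    collapseBlocks n S φ (n * x) = n * x := by
  simp [collapseBlocks, hfix, Nat.mul_div_cancel_left x (Nat.pos_of_ne_zero hn)]

lemma collapseBlocks_mem_Icc (hn : n ≠ 0) (hφ : Monotone φ) (hfix : ∀ x, φ (n * x) = n * x)
    (j : ℕ) : collapseBlocks n S φ j ∈ Set.Icc (n * (j / n)) (n * (j / n + 1)) := by
  unfold collapseBlocks
  split_ifs
  · exact ⟨le_rfl, by gcongr; omega⟩
  · rw [← hfix, ← hfix (j / n + 1)]
    exact ⟨hφ (Nat.mul_div_le j n), hφ (Nat.lt_mul_div_succ j (Nat.pos_of_ne_zero hn)).le⟩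

lemma monotone_collapseBlocks (hn : n ≠ 0) (hφ : Monotone φ) (hfix : ∀ x, φ (n * x) = n * x) :
    Monotone (collapseBlocks n S φ) := by
  intro i j hij
  rcases (Nat.div_le_div_right (c := n) hij).eq_or_lt with h | h
  · by_cases hS : j / n ∈ S
    · simp [collapseBlocks, h, hS]
    · simpa [collapseBlocks, h, hS] using hφ hij
  · calc collapseBlocks n S φ i ≤ n * (i / n + 1) := (collapseBlocks_mem_Icc hn hφ hfix i).2
      _ ≤ n * (j / n) := Nat.mul_le_mul_left _ h
      _ ≤ collapseBlocks n S φ j := (collapseBlocks_mem_Icc hn hφ hfix j).1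

lemma collapseBlocks_of_mem {x j : ℕ} (hx : x ∈ S) (hj : j ∈ Finset.Ico (n * x) (n * (x + 1))) :
    collapseBlocks n S φ j = n * x := by
  rw [Finset.mem_Ico, mul_comm n, mul_comm n] at hj
  simp [collapseBlocks, Nat.div_eq_of_lt_le hj.1 hj.2, hx]

lemma collapseBlocks_of_notMem (hn : n ≠ 0) (hfix : ∀ x, φ (n * x) = n * x) {x j : ℕ} (hx : x ∉ S)
    (hj : j ∈ Finset.Icc (n * x) (n * (x + 1))) : collapseBlocks n S φ j = φ j := by
  rw [Finset.mem_Icc] at hj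
  rcases hj.2.eq_or_lt with rfl | hlt
  · rw [collapseBlocks_mul hn hfix, hfix]
  · rw [mul_comm n, mul_comm n] at *
    simp [collapseBlocks, Nat.div_eq_of_lt_le hj.1 hlt, hx]

lemma le_sum_collapseBlocks_of_mem (hn : n ≠ 0) (hfix : ∀ x, φ (n * x) = n * x)
    (hg : ∀ s t, 0 ≤ g s t) {x : ℕ} (hx : x ∈ S) :
    g (n * x) (n * (x + 1)) ≤ ∑ j ∈ Finset.Ico (n * x) (n * (x + 1)),
      g (collapseBlocks n S φ j) (collapseBlocks n S φ (j + 1)) := by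
  have hlast : n * (x + 1) - 1 ∈ Finset.Ico (n * x) (n * (x + 1)) := by
    rw [Finset.mem_Ico, mul_add]
    omega
  have hsucc : n * (x + 1) - 1 + 1 = n * (x + 1) := by
    rw [mul_add]
    omega
  calc g (n * x) (n * (x + 1)) = g (collapseBlocks n S φ (n * (x + 1) - 1))
        (collapseBlocks n S φ (n * (x + 1) - 1 + 1)) := by
        rw [collapseBlocks_of_mem hx hlast, hsucc, collapseBlocks_mul hn hfix]
    _ ≤ _ := Finset.single_le_sum
        (f := fun j => g (collapseBlocks n S φ j) (collapseBlocks n S φ (j + 1)))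
        (fun j _ => hg _ _) hlast

lemma sum_collapseBlocks_of_notMem (hn : n ≠ 0) (hfix : ∀ x, φ (n * x) = n * x) {x : ℕ}
    (hx : x ∉ S) :
    ∑ j ∈ Finset.Ico (n * x) (n * (x + 1)),
      g (collapseBlocks n S φ j) (collapseBlocks n S φ (j + 1)) =
      ∑ j ∈ Finset.Ico (n * x) (n * (x + 1)), g (φ j) (φ (j + 1)) := by
  refine Finset.sum_congr rfl fun j hj => ?_
  rw [Finset.mem_Ico] at hj
  rw [collapseBlocks_of_notMem hn hfix hx (Finset.mem_Icc.2 ⟨hj.1, hj.2.le⟩),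
    collapseBlocks_of_notMem hn hfix hx (Finset.mem_Icc.2 ⟨by omega, hj.2⟩)]

end CollapseBlocks

theorem exists_monotone_adicVariation_le_sum (hB : B ≠ 0) (hg : ∀ s t, 0 ≤ g s t) (k : ℕ) :
    ∃ φ : ℕ → ℕ, Monotone φ ∧ (∀ x, φ (B ^ k * x) = B ^ k * x) ∧ ∀ x, adicVariation B g k x ≤
      ∑ j ∈ Finset.Ico (B ^ k * x) (B ^ k * (x + 1)), g (φ j) (φ (j + 1)) := by
  induction k with
  | zero => exact ⟨id, monotone_id, fun x => rfl, fun x => by simp [adicVariation_zero]⟩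
  | succ k ih =>
    obtain ⟨φ, hφ, hfix, hle⟩ := ih
    have hfix' (x : ℕ) : φ (B ^ (k + 1) * x) = B ^ (k + 1) * x := by
      rw [pow_succ, mul_assoc, hfix]
    have hn : B ^ (k + 1) ≠ 0 := pow_ne_zero _ hB
    let S : Set ℕ := {x | ∑ y ∈ Finset.Ico (B * x) (B * (x + 1)), adicVariation B g k y <
      g (B ^ (k + 1) * x) (B ^ (k + 1) * (x + 1))}
    refine ⟨collapseBlocks (B ^ (k + 1)) S φ, monotone_collapseBlocks hn hφ hfix',
      collapseBlocks_mul hn hfix', fun x => ?_⟩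
    by_cases hx : x ∈ S
    · rw [adicVariation_succ, max_eq_right hx.le]
      exact le_sum_collapseBlocks_of_mem hn hfix' hg hx
    · rw [adicVariation_succ, max_eq_left (not_lt.1 hx), sum_collapseBlocks_of_notMem hn hfix' hx,
        pow_succ, mul_assoc, mul_assoc,
        ← sum_Ico_sum_Ico_mul (B ^ k) _ (Nat.mul_le_mul_left B (Nat.le_succ x))]
      exact Finset.sum_le_sum fun y _ => hle y

end AdicVariation

section SymmetricSteps

open ProbabilityTheory Complex

lemma norm_one_add_mul_I_le {δ x : ℝ} (hx : |x| ≤ 1) :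
    ‖1 + (δ * x : ℝ) * I‖ ≤ Real.exp (δ ^ 2 / 2) := by
  have hsq : ‖1 + (δ * x : ℝ) * I‖ ^ 2 = 1 + (δ * x) ^ 2 := by
    rw [← normSq_eq_norm_sq]
    simp [normSq_apply]
    ring
  refine le_of_sq_le_sq ?_ (Real.exp_pos _).le
  calc ‖1 + (δ * x : ℝ) * I‖ ^ 2 ≤ 1 + δ ^ 2 := by
        rw [hsq, mul_pow]
        gcongr
        exact mul_le_of_le_one_right (sq_nonneg δ) ((sq_le_one_iff_abs_le_one x).2 hx)
    _ ≤ Real.exp (δ ^ 2) := by linarith [Real.add_one_le_exp (δ ^ 2)]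
    _ = Real.exp (δ ^ 2 / 2) ^ 2 := by rw [← Real.exp_nat_mul]; ring_nf

lemma exp_half_le_two : Real.exp (1 / 2) ≤ 2 := by
  have := Real.exp_bound_div_one_sub_of_interval' (x := 1 / 2) (by norm_num) (by norm_num)
  norm_num at this ⊢
  linarith

lemma norm_prod_one_add_mul_I_le {δ : ℝ} {u : ℕ → ℝ} {s : Finset ℕ} (hu : ∀ i ∈ s, |u i| ≤ 1)
    (hδ : δ ^ 2 * s.card ≤ 1) : ‖∏ i ∈ s, (1 + (δ * u i : ℝ) * I)‖ ≤ 2 := by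
  calc ‖∏ i ∈ s, (1 + (δ * u i : ℝ) * I)‖ ≤ ∏ i ∈ s, Real.exp (δ ^ 2 / 2) := by
        rw [norm_prod]
        exact Finset.prod_le_prod (fun _ _ => norm_nonneg _) fun i hi =>
          norm_one_add_mul_I_le (hu i hi)
    _ = Real.exp (δ ^ 2 * s.card / 2) := by
        rw [Finset.prod_const, ← Real.exp_nat_mul]
        ring_nf
    _ ≤ Real.exp (1 / 2) := by gcongr
    _ ≤ 2 := exp_half_le_two

lemma integral_ofReal_add_ofReal_mul_I {Ω : Type*} [MeasurableSpace Ω] {μ : Measure Ω}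
    {f g : Ω → ℝ} (hf : Integrable f μ) (hg : Integrable g μ) :
    ∫ ω, ((f ω : ℂ) + (g ω : ℂ) * I) ∂μ = (∫ ω, f ω ∂μ : ℝ) + (∫ ω, g ω ∂μ : ℝ) * I := by
  rw [← integral_complex_ofReal, ← integral_complex_ofReal, ← integral_mul_const]
  exact integral_add hf.ofReal (hg.ofReal.mul_const I)

/-- Steps of a symmetric random walk: independent symmetric random variables with values in
`[-1, 1]` and second moment at least `1 / 2`. -/
structure IsSymmetricSteps {Ω : Type*} [MeasurableSpace Ω] (X : ℕ → Ω → ℝ) (μ : Measure Ω) :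
    Prop where
  measurable : ∀ i, Measurable (X i)
  indep : iIndepFun X μ
  identDistrib_neg : ∀ i, IdentDistrib (X i) (fun ω => -X i ω) μ μ
  abs_le_one : ∀ i ω, |X i ω| ≤ 1
  half_le_integral_sq : ∀ i, 1 / 2 ≤ ∫ ω, X i ω ^ 2 ∂μ

namespace IsSymmetricSteps

variable {Ω : Type*} [MeasurableSpace Ω] {X : ℕ → Ω → ℝ} {μ : Measure Ω}

lemma integral_eq_zero (hX : IsSymmetricSteps X μ) (i : ℕ) : ∫ ω, X i ω ∂μ = 0 := by
  have := (hX.identDistrib_neg i).integral_eq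
  rw [integral_neg] at this
  linarith

variable [IsProbabilityMeasure μ]

lemma memLp (hX : IsSymmetricSteps X μ) (i : ℕ) (p : ℝ≥0∞) : MemLp (X i) p μ :=
  .of_bound (hX.measurable i).aestronglyMeasurable 1 (.of_forall (hX.abs_le_one i))

lemma integrable (hX : IsSymmetricSteps X μ) (i : ℕ) : Integrable (X i) μ :=
  memLp_one_iff_integrable.1 (hX.memLp i 1)

lemma integral_mul_prod_one_add_mul_I (hX : IsSymmetricSteps X μ) (δ : ℝ) {s : Finset ℕ} {j : ℕ}
    (hj : j ∈ s) : ∫ ω, X j ω * ∏ i ∈ s, (1 + (δ * X i ω : ℝ) * I) ∂μ =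
      ((δ * ∫ ω, X j ω ^ 2 ∂μ : ℝ) : ℂ) * I := by
  let G (i : ℕ) (x : ℝ) : ℂ := (if i = j then (x : ℂ) else 1) * (1 + (δ * x : ℝ) * I)
  have hG (i : ℕ) : Measurable (G i) := by
    dsimp only [G]
    split_ifs <;> fun_prop
  have hind : iIndepFun (fun (i : s) ω => G i (X i ω)) μ :=
    (hX.indep.precomp Subtype.val_injective).comp (fun i : s => G i) fun i => hG i
  have hsplit (ω : Ω) : X j ω * ∏ i ∈ s, (1 + (δ * X i ω : ℝ) * I) = ∏ i : s, G i (X i ω) := by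
    rw [Finset.univ_eq_attach, Finset.prod_attach s (fun i => G i (X i ω)),
      Finset.prod_mul_distrib, Finset.prod_ite_eq' s j, if_pos hj]
  have hfactor (i : ℕ) : ∫ ω, G i (X i ω) ∂μ =
      if i = j then ((δ * ∫ ω, X j ω ^ 2 ∂μ : ℝ) : ℂ) * I else 1 := by
    split_ifs with h
    · have hform (ω : Ω) : G i (X i ω) = (X i ω : ℂ) + ((δ * X i ω ^ 2 : ℝ) : ℂ) * I := by
        simp only [G, if_pos h]
        push_cast
        ring
      simp_rw [hform]
      rw [integral_ofReal_add_ofReal_mul_I (hX.integrable i)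
        (((hX.memLp i 2).integrable_sq).const_mul δ),
        integral_const_mul, hX.integral_eq_zero, h]
      simp
    · have hform (ω : Ω) : G i (X i ω) = ((1 : ℝ) : ℂ) + ((δ * X i ω : ℝ) : ℂ) * I := by
        simp only [G, if_neg h, one_mul, ofReal_one]
      simp_rw [hform]
      rw [integral_ofReal_add_ofReal_mul_I (integrable_const 1) ((hX.integrable i).const_mul δ),
        integral_const_mul, hX.integral_eq_zero]
      simp
  simp_rw [hsplit]
  rw [hind.integral_fun_prod_eq_prod_integral fun i =>
    ((hG i).comp (hX.measurable i)).aestronglyMeasurable]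
  rw [Finset.univ_eq_attach, Finset.prod_attach s (fun i => ∫ ω, G i (X i ω) ∂μ)]
  simp [hfactor, hj]

lemma integral_sum_mul_prod_one_add_mul_I (hX : IsSymmetricSteps X μ) {δ : ℝ} {s : Finset ℕ}
    (hδ : δ ^ 2 * s.card ≤ 1) :
    ∫ ω, (∑ j ∈ s, X j ω : ℝ) * ∏ i ∈ s, (1 + (δ * X i ω : ℝ) * I) ∂μ =
      ((δ * ∑ j ∈ s, ∫ ω, X j ω ^ 2 ∂μ : ℝ) : ℂ) * I := by
  have hmeas : Measurable fun ω => ∏ i ∈ s, (1 + (δ * X i ω : ℝ) * I) := by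
    have := hX.measurable
    fun_prop
  have hint (j : ℕ) : Integrable (fun ω => X j ω * ∏ i ∈ s, (1 + (δ * X i ω : ℝ) * I)) μ :=
    (hX.integrable j).ofReal.mul_bdd hmeas.aestronglyMeasurable
      (.of_forall fun ω => norm_prod_one_add_mul_I_le (fun i _ => hX.abs_le_one i ω) hδ)
  simp_rw [ofReal_sum, Finset.sum_mul]
  rw [integral_finsetSum _ fun j _ => hint j,
    Finset.sum_congr rfl fun j hj => hX.integral_mul_prod_one_add_mul_I δ hj, Finset.mul_sum,
    ofReal_sum, Finset.sum_mul]

/-- Khinchine's inequality: the proof tests `∑ X i` against the Riesz product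
`∏ (1 + i δ X i)`. -/
lemma sqrt_card_div_four_le_integral_abs_sum (hX : IsSymmetricSteps X μ) (s : Finset ℕ) :
    √s.card / 4 ≤ ∫ ω, |∑ i ∈ s, X i ω| ∂μ := by
  rcases s.eq_empty_or_nonempty with rfl | hs
  · simp
  have hcard : (0 : ℝ) < s.card := by exact_mod_cast hs.card_pos
  set δ : ℝ := (√s.card)⁻¹
  have hδ : δ ^ 2 * s.card = 1 := by
    rw [inv_pow, Real.sq_sqrt hcard.le, inv_mul_cancel₀ hcard.ne']
  let R (ω : Ω) : ℂ := ∏ i ∈ s, (1 + (δ * X i ω : ℝ) * I)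
  have hR (ω : Ω) : ‖R ω‖ ≤ 2 := norm_prod_one_add_mul_I_le (fun i _ => hX.abs_le_one i ω) hδ.le
  have hsum : Integrable (fun ω => ∑ i ∈ s, X i ω) μ :=
    integrable_finsetSum _ fun i _ => hX.integrable i
  have hlower : δ * (s.card * (1 / 2)) ≤ ‖∫ ω, (∑ i ∈ s, X i ω : ℝ) * R ω ∂μ‖ := by
    rw [hX.integral_sum_mul_prod_one_add_mul_I hδ.le, norm_mul, norm_I, mul_one, norm_real]
    refine (le_abs_self _).trans' ?_
    gcongr
    simpa using Finset.card_nsmul_le_sum s _ _ fun i _ => hX.half_le_integral_sq i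
  have hupper : ‖∫ ω, (∑ i ∈ s, X i ω : ℝ) * R ω ∂μ‖ ≤ ∫ ω, |∑ i ∈ s, X i ω| * 2 ∂μ := by
    refine norm_integral_le_of_norm_le (hsum.abs.mul_const 2) (.of_forall fun ω => ?_)
    rw [norm_mul, norm_real, Real.norm_eq_abs]
    gcongr
    exact hR ω
  rw [integral_mul_const] at hupper
  have hδcard : δ * s.card = √s.card := by
    rw [inv_mul_eq_div, Real.div_sqrt]
  linarith

end IsSymmetricSteps

end SymmetricSteps

section SquareVariation

open ProbabilityTheory

/-- The squared increment of the walk with steps `u` between the times `s` and `t`. -/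
def sqIncrement (u : ℕ → ℝ) (s t : ℕ) : ℝ := (∑ i ∈ Finset.Ico s t, u i) ^ 2

lemma sqIncrement_nonneg (u : ℕ → ℝ) (s t : ℕ) : 0 ≤ sqIncrement u s t := sq_nonneg _

/-- Changes the sign of `u` on the blocks `[n * y, n * (y + 1))` with `y ∈ σ`. -/
def flipBlocks (n : ℕ) (σ : Finset ℕ) (u : ℕ → ℝ) (j : ℕ) : ℝ :=
  if j / n ∈ σ then -u j else u j

lemma sum_flipBlocks {n s t y : ℕ} (σ : Finset ℕ) (u : ℕ → ℝ) (hs : n * y ≤ s)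
    (ht : t ≤ n * (y + 1)) : ∑ j ∈ Finset.Ico s t, flipBlocks n σ u j =
      if y ∈ σ then -∑ j ∈ Finset.Ico s t, u j else ∑ j ∈ Finset.Ico s t, u j := by
  have hdiv (j : ℕ) (hj : j ∈ Finset.Ico s t) : j / n = y := by
    rw [Finset.mem_Ico] at hj
    exact Nat.div_eq_of_lt_le (by linarith) (by linarith)
  rw [Finset.sum_congr rfl fun j hj => by rw [flipBlocks, hdiv j hj]]
  split_ifs <;> simp

variable {B : ℕ}

lemma adicVariation_flipBlocks (hB : B ≠ 0) (k y : ℕ) (σ : Finset ℕ) (u : ℕ → ℝ) :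
    adicVariation B (sqIncrement (flipBlocks (B ^ k) σ u)) k y =
      adicVariation B (sqIncrement u) k y := by
  refine adicVariation_congr hB fun s t hs _ ht => ?_
  rw [sqIncrement, sum_flipBlocks σ u hs ht, sqIncrement]
  split_ifs <;> simp

lemma exists_flipBlocks_sqIncrement_eq (k x : ℕ) (u : ℕ → ℝ) :
    ∃ σ ⊆ Finset.Ico (B * x) (B * (x + 1)),
      sqIncrement (flipBlocks (B ^ k) σ u) (B ^ (k + 1) * x) (B ^ (k + 1) * (x + 1)) =
        (∑ y ∈ Finset.Ico (B * x) (B * (x + 1)),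
          |∑ j ∈ Finset.Ico (B ^ k * y) (B ^ k * (y + 1)), u j|) ^ 2 := by
  refine ⟨(Finset.Ico (B * x) (B * (x + 1))).filter fun y =>
    ∑ j ∈ Finset.Ico (B ^ k * y) (B ^ k * (y + 1)), u j < 0, Finset.filter_subset _ _, ?_⟩
  rw [sqIncrement, pow_succ B k, mul_assoc, mul_assoc,
    ← sum_Ico_sum_Ico_mul (B ^ k) _ (Nat.mul_le_mul_left B (Nat.le_succ x))]
  congr 1
  refine Finset.sum_congr rfl fun y hy => ?_
  rw [sum_flipBlocks _ u le_rfl le_rfl]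
  split_ifs with hneg
  · rw [abs_of_neg (Finset.mem_filter.1 hneg).2]
  · rw [abs_of_nonneg (not_lt.1 fun h => hneg (Finset.mem_filter.2 ⟨hy, h⟩))]

/-- Flipping blocks does not change their variations, so every term on the right is nonnegative;
the flip that makes all block sums nonnegative contributes the left-hand side. -/
lemma sq_sum_abs_sub_le_sum_flipBlocks (hB : B ≠ 0) (k x : ℕ) (u : ℕ → ℝ) :
    (∑ y ∈ Finset.Ico (B * x) (B * (x + 1)),
        |∑ j ∈ Finset.Ico (B ^ k * y) (B ^ k * (y + 1)), u j|) ^ 2 -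
        ∑ y ∈ Finset.Ico (B * x) (B * (x + 1)), adicVariation B (sqIncrement u) k y ≤
      ∑ σ ∈ (Finset.Ico (B * x) (B * (x + 1))).powerset,
        (adicVariation B (sqIncrement (flipBlocks (B ^ k) σ u)) (k + 1) x -
          ∑ y ∈ Finset.Ico (B * x) (B * (x + 1)), adicVariation B (sqIncrement u) k y) := by
  obtain ⟨σ, hσ, hsq⟩ := exists_flipBlocks_sqIncrement_eq k x u
  have hsucc (τ : Finset ℕ) : adicVariation B (sqIncrement (flipBlocks (B ^ k) τ u)) (k + 1) x =
      max (∑ y ∈ Finset.Ico (B * x) (B * (x + 1)), adicVariation B (sqIncrement u) k y)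
        (sqIncrement (flipBlocks (B ^ k) τ u) (B ^ (k + 1) * x) (B ^ (k + 1) * (x + 1))) := by
    simp only [adicVariation_succ, adicVariation_flipBlocks hB]
  simp only [hsucc]
  refine (Finset.single_le_sum (fun τ _ => sub_nonneg.2 (le_max_left _ _))
    (Finset.mem_powerset.2 hσ)).trans' ?_
  rw [hsq]
  exact sub_le_sub_right (le_max_right _ _) _

lemma measurable_adicVariation_sqIncrement (B k x : ℕ) :
    Measurable fun u : ℕ → ℝ => adicVariation B (sqIncrement u) k x := by
  have hsq (s t : ℕ) : Measurable fun u : ℕ → ℝ => sqIncrement u s t := by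
    unfold sqIncrement
    fun_prop
  induction k generalizing x with
  | zero => exact hsq _ _
  | succ k ih => exact (Finset.measurable_fun_sum _ fun y _ => ih y).max (hsq _ _)

lemma adicVariation_sqIncrement_le (hB : B ≠ 0) {u : ℕ → ℝ} (hu : ∀ i, |u i| ≤ 1) (k x : ℕ) :
    adicVariation B (sqIncrement u) k x ≤ (B ^ k) ^ 2 * B ^ k := by
  refine adicVariation_le hB (by positivity) fun s t hs hst ht => ?_
  have hlen : t - s ≤ B ^ k := by
    rw [mul_add_one] at ht
    omega
  have habs : |∑ i ∈ Finset.Ico s t, u i| ≤ (B ^ k : ℕ) := by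
    calc |∑ i ∈ Finset.Ico s t, u i| ≤ ∑ _ ∈ Finset.Ico s t, (1 : ℝ) :=
          (Finset.abs_sum_le_sum_abs _ _).trans (Finset.sum_le_sum fun i _ => hu i)
      _ = (t - s : ℕ) := by simp
      _ ≤ (B ^ k : ℕ) := by exact_mod_cast hlen
  rw [sqIncrement, ← sq_abs]
  exact pow_le_pow_left₀ (abs_nonneg _) (mod_cast habs) 2

namespace IsSymmetricSteps

variable {Ω : Type*} [MeasurableSpace Ω] {X : ℕ → Ω → ℝ} {μ : Measure Ω}

lemma identDistrib_flipBlocks (hX : IsSymmetricSteps X μ) (n : ℕ) (σ : Finset ℕ) :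
    IdentDistrib (fun ω => flipBlocks n σ fun i => X i ω) (fun ω i => X i ω) μ μ := by
  have hmeas (i : ℕ) : Measurable fun x : ℝ => if i / n ∈ σ then -x else x := by
    split_ifs <;> fun_prop
  refine (IdentDistrib.pi (fun i => ?_) hX.indep (hX.indep.comp _ hmeas)).symm
  by_cases hi : i / n ∈ σ
  · simpa [Function.comp_def, hi] using hX.identDistrib_neg i
  · simpa [Function.comp_def, hi] using IdentDistrib.refl (hX.measurable i).aemeasurable

lemma measurable_adicVariation (hX : IsSymmetricSteps X μ) (B k x : ℕ) :
    Measurable fun ω => adicVariation B (sqIncrement fun i => X i ω) k x :=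
  (measurable_adicVariation_sqIncrement B k x).comp (measurable_pi_lambda _ hX.measurable)

lemma integral_adicVariation_flipBlocks (hX : IsSymmetricSteps X μ) (k x n : ℕ) (σ : Finset ℕ) :
    ∫ ω, adicVariation B (sqIncrement (flipBlocks n σ fun i => X i ω)) k x ∂μ =
      ∫ ω, adicVariation B (sqIncrement fun i => X i ω) k x ∂μ :=
  ((hX.identDistrib_flipBlocks n σ).comp (measurable_adicVariation_sqIncrement B k x)).integral_eq

variable [IsProbabilityMeasure μ]

lemma memLp_adicVariation (hX : IsSymmetricSteps X μ) (hB : B ≠ 0) (k x : ℕ) (p : ℝ≥0∞) :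
    MemLp (fun ω => adicVariation B (sqIncrement fun i => X i ω) k x) p μ := by
  refine .of_bound (hX.measurable_adicVariation B k x).aestronglyMeasurable ((B ^ k) ^ 2 * B ^ k)
    (.of_forall fun ω => ?_)
  rw [Real.norm_of_nonneg (adicVariation_nonneg hB (sqIncrement_nonneg _) k x)]
  exact adicVariation_sqIncrement_le hB (hX.abs_le_one · ω) k x

lemma integrable_adicVariation (hX : IsSymmetricSteps X μ) (hB : B ≠ 0) (k x : ℕ) :
    Integrable (fun ω => adicVariation B (sqIncrement fun i => X i ω) k x) μ :=
  memLp_one_iff_integrable.1 (hX.memLp_adicVariation hB k x 1)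

lemma sq_mul_pow_div_le_integral_sq_sum_abs (hX : IsSymmetricSteps X μ) (k x : ℕ) :
    (B : ℝ) ^ 2 * B ^ k / 16 ≤ ∫ ω, (∑ y ∈ Finset.Ico (B * x) (B * (x + 1)),
      |∑ j ∈ Finset.Ico (B ^ k * y) (B ^ k * (y + 1)), X j ω|) ^ 2 ∂μ := by
  set Z : Ω → ℝ := fun ω => ∑ y ∈ Finset.Ico (B * x) (B * (x + 1)),
    |∑ j ∈ Finset.Ico (B ^ k * y) (B ^ k * (y + 1)), X j ω|
  have habs (y : ℕ) :
      MemLp (fun ω => |∑ j ∈ Finset.Ico (B ^ k * y) (B ^ k * (y + 1)), X j ω|) 2 μ :=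
    (memLp_finsetSum _ fun j _ => hX.memLp j 2).abs
  have hZ : MemLp Z 2 μ := memLp_finsetSum _ fun y _ => habs y
  have hmean : B * (√(B ^ k) / 4) ≤ ∫ ω, Z ω ∂μ := by
    rw [integral_finsetSum _ fun y _ => (habs y).integrable one_le_two]
    have := Finset.card_nsmul_le_sum (Finset.Ico (B * x) (B * (x + 1))) _ (√(B ^ k) / 4)
      fun y _ => by
        simpa [← Nat.mul_sub] using
          hX.sqrt_card_div_four_le_integral_abs_sum (Finset.Ico (B ^ k * y) (B ^ k * (y + 1)))
    simpa [← Nat.mul_sub] using this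
  have hvar := variance_nonneg Z μ
  rw [variance_eq_sub hZ] at hvar
  calc (B : ℝ) ^ 2 * B ^ k / 16 = (B * (√(B ^ k) / 4)) ^ 2 := by
        rw [mul_pow, div_pow, Real.sq_sqrt (by positivity)]
        ring
    _ ≤ (∫ ω, Z ω ∂μ) ^ 2 := by gcongr
    _ ≤ ∫ ω, Z ω ^ 2 ∂μ := by simpa using hvar

lemma integrable_adicVariation_flipBlocks (hX : IsSymmetricSteps X μ) (hB : B ≠ 0) (k x n : ℕ)
    (σ : Finset ℕ) :
    Integrable (fun ω => adicVariation B (sqIncrement (flipBlocks n σ fun i => X i ω)) k x) μ :=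
  ((hX.identDistrib_flipBlocks n σ).comp
    (measurable_adicVariation_sqIncrement B k x)).symm.integrable_snd
    (hX.integrable_adicVariation hB k x)

lemma sub_le_two_pow_mul_integral_adicVariation_sub (hX : IsSymmetricSteps X μ) (hB : B ≠ 0)
    (k x : ℕ) :
    (B : ℝ) ^ 2 * B ^ k / 16 - ∑ y ∈ Finset.Ico (B * x) (B * (x + 1)),
        ∫ ω, adicVariation B (sqIncrement fun i => X i ω) k y ∂μ ≤
      2 ^ B * (∫ ω, adicVariation B (sqIncrement fun i => X i ω) (k + 1) x ∂μ -
        ∑ y ∈ Finset.Ico (B * x) (B * (x + 1)),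
          ∫ ω, adicVariation B (sqIncrement fun i => X i ω) k y ∂μ) := by
  set Y := Finset.Ico (B * x) (B * (x + 1))
  have hchild : Integrable (fun ω => ∑ y ∈ Y, adicVariation B (sqIncrement fun i => X i ω) k y) μ :=
    integrable_finsetSum _ fun y _ => hX.integrable_adicVariation hB k y
  have hsq : Integrable (fun ω =>
      (∑ y ∈ Y, |∑ j ∈ Finset.Ico (B ^ k * y) (B ^ k * (y + 1)), X j ω|) ^ 2) μ :=
    (memLp_finsetSum _ fun y _ =>
      (memLp_finsetSum _ fun j _ => hX.memLp j 2).abs).integrable_sq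
  have hflip (σ : Finset ℕ) := hX.integrable_adicVariation_flipBlocks hB (k + 1) x (B ^ k) σ
  have hgain (σ : Finset ℕ) : Integrable (fun ω =>
      adicVariation B (sqIncrement (flipBlocks (B ^ k) σ fun i => X i ω)) (k + 1) x -
        ∑ y ∈ Y, adicVariation B (sqIncrement fun i => X i ω) k y) μ := (hflip σ).sub hchild
  have hchild_integral := integral_finsetSum Y fun y _ => hX.integrable_adicVariation hB k y
  calc _ ≤ (∫ ω, (∑ y ∈ Y, |∑ j ∈ Finset.Ico (B ^ k * y) (B ^ k * (y + 1)), X j ω|) ^ 2 ∂μ) -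
        ∫ ω, ∑ y ∈ Y, adicVariation B (sqIncrement fun i => X i ω) k y ∂μ := by
        rw [hchild_integral]
        exact sub_le_sub_right (hX.sq_mul_pow_div_le_integral_sq_sum_abs k x) _
    _ ≤ ∫ ω, ∑ σ ∈ Y.powerset,
          (adicVariation B (sqIncrement (flipBlocks (B ^ k) σ fun i => X i ω)) (k + 1) x -
            ∑ y ∈ Y, adicVariation B (sqIncrement fun i => X i ω) k y) ∂μ := by
        rw [← integral_sub hsq hchild]
        exact integral_mono (hsq.sub hchild) (integrable_finsetSum _ fun σ _ => hgain σ)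
          fun ω => sq_sum_abs_sub_le_sum_flipBlocks hB k x fun i => X i ω
    _ = _ := by
        rw [integral_finsetSum _ fun σ _ => hgain σ]
        simp only [integral_sub (hflip _) hchild, hX.integral_adicVariation_flipBlocks]
        simp [hchild_integral, Y, ← Nat.mul_sub, mul_sub]

lemma le_integral_adicVariation (hX : IsSymmetricSteps X μ) (hB : B ≠ 0) (k x : ℕ) :
    B / 16 * (1 - (1 - (2 ^ B)⁻¹) ^ k) * B ^ k ≤
      ∫ ω, adicVariation B (sqIncrement fun i => X i ω) k x ∂μ := by
  induction k generalizing x with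
  | zero => simpa using integral_nonneg fun ω => adicVariation_nonneg hB (sqIncrement_nonneg _) 0 x
  | succ k ih =>
    have hstep := hX.sub_le_two_pow_mul_integral_adicVariation_sub hB k x
    have hchild := Finset.card_nsmul_le_sum (Finset.Ico (B * x) (B * (x + 1))) _ _ fun y _ => ih y
    rw [Nat.card_Ico, ← Nat.mul_sub, Nat.add_sub_cancel_left, mul_one, nsmul_eq_mul] at hchild
    set a := ∑ y ∈ Finset.Ico (B * x) (B * (x + 1)),
      ∫ ω, adicVariation B (sqIncrement fun i => X i ω) k y ∂μ
    set e := ∫ ω, adicVariation B (sqIncrement fun i => X i ω) (k + 1) x ∂μ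
    have hpow : (1 : ℝ) ≤ 2 ^ B := one_le_pow₀ one_le_two
    have hcoef : 0 ≤ 1 - ((2 : ℝ) ^ B)⁻¹ := sub_nonneg.2 (inv_le_one_of_one_le₀ hpow)
    have hmix : (1 - (2 ^ B)⁻¹) * a + (2 ^ B)⁻¹ * ((B : ℝ) ^ 2 * B ^ k / 16) ≤ e := by
      have hcancel : ((2 : ℝ) ^ B)⁻¹ * 2 ^ B = 1 := inv_mul_cancel₀ (by positivity)
      have hscaled := mul_le_mul_of_nonneg_left hstep (inv_nonneg.2 (zero_le_one.trans hpow))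
      linear_combination hscaled + (e - a) * hcancel
    refine (le_trans (le_of_eq ?_) (add_le_add_left (mul_le_mul_of_nonneg_left hchild hcoef)
      _)).trans hmix
    ring

lemma exists_le_integral_adicVariation (hX : IsSymmetricSteps X μ) (hB : B ≠ 0) :
    ∃ k, ∀ x, (B : ℝ) / 32 * B ^ k ≤ ∫ ω, adicVariation B (sqIncrement fun i => X i ω) k x ∂μ := by
  have : (1 : ℝ) ≤ 2 ^ B := one_le_pow₀ one_le_two
  obtain ⟨k, hk⟩ := exists_pow_lt_of_lt_one (y := 1 - ((2 : ℝ) ^ B)⁻¹) one_half_pos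
    (sub_lt_self 1 (by positivity))
  refine ⟨k, fun x => (hX.le_integral_adicVariation hB k x).trans' ?_⟩
  gcongr
  have : (0 : ℝ) ≤ B := B.cast_nonneg
  nlinarith

end IsSymmetricSteps

end SquareVariation

section LawOfLargeNumbers

open ProbabilityTheory

lemma half_le_measure_of_pairwise_indepFun {Ω : Type*} [MeasurableSpace Ω] {μ : Measure Ω}
    [IsProbabilityMeasure μ] {Z : ℕ → Ω → ℝ} {m K : ℝ} (hm : 0 < m)
    (hZm : ∀ x, Measurable (Z x)) (hZ : ∀ x ω, Z x ω ∈ Set.Icc 0 K)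
    (hind : Pairwise fun x y => IndepFun (Z x) (Z y) μ) (hmean : ∀ x, m ≤ ∫ ω, Z x ω ∂μ) {N : ℕ}
    (hN : N ≠ 0) (hNK : 2 * K ^ 2 ≤ m ^ 2 * N) :
    1 / 2 ≤ μ {ω | m / 2 * N ≤ ∑ x ∈ Finset.range N, Z x ω} := by
  have : (0 : ℝ) < N := by positivity
  have hZ2 (x : ℕ) : MemLp (Z x) 2 μ := memLp_of_bounded (.of_forall (hZ x))
    (hZm x).aestronglyMeasurable 2
  set S : Ω → ℝ := ∑ x ∈ Finset.range N, Z x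
  have hS2 : MemLp S 2 μ := memLp_finsetSum' _ fun x _ => hZ2 x
  have hSmean : m * N ≤ ∫ ω, S ω ∂μ := by
    simp only [S, Finset.sum_apply]
    rw [integral_finsetSum _ fun x _ => (hZ2 x).integrable one_le_two]
    have := Finset.card_nsmul_le_sum (Finset.range N) _ m fun x _ => hmean x
    rwa [Finset.card_range, nsmul_eq_mul, mul_comm] at this
  have hSvar : variance S μ ≤ N * (K / 2) ^ 2 := by
    rw [IndepFun.variance_sum (fun x _ => hZ2 x) fun x _ y _ hxy => hind hxy]
    have := Finset.sum_le_card_nsmul (Finset.range N) _ (((K - 0) / 2) ^ 2) fun x _ =>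
      variance_le_sq_of_bounded (μ := μ) (.of_forall (hZ x)) (hZm x).aemeasurable
    rwa [Finset.card_range, nsmul_eq_mul, sub_zero] at this
  have hdev : μ {ω | m / 2 * N ≤ |S ω - ∫ ω, S ω ∂μ|} ≤ 1 / 2 := by
    refine (meas_ge_le_variance_div_sq hS2 (by positivity)).trans ?_
    rw [show (1 / 2 : ℝ≥0∞) = ENNReal.ofReal (1 / 2) by simp]
    refine ENNReal.ofReal_le_ofReal ((div_le_iff₀ (by positivity)).2 (hSvar.trans ?_))
    nlinarith
  have hcover : Set.univ ⊆ {ω | m / 2 * N ≤ ∑ x ∈ Finset.range N, Z x ω} ∪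
      {ω | m / 2 * N ≤ |S ω - ∫ ω, S ω ∂μ|} := by
    intro ω _
    by_contra! h
    simp only [Set.mem_union, Set.mem_ofPred_eq, not_or, not_le] at h
    have hSω : S ω = ∑ x ∈ Finset.range N, Z x ω := Finset.sum_apply ω _ _
    linarith [neg_abs_le (S ω - ∫ ω, S ω ∂μ)]
  have htotal := ((measure_mono hcover).trans (measure_union_le _ _)).trans
    (add_le_add_right hdev _)
  rw [measure_univ] at htotal
  exact (ENNReal.add_le_add_iff_right (a := 1 / 2) (by simp)).1
    ((ENNReal.add_halves 1).trans_le htotal)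

variable {B : ℕ}

namespace IsSymmetricSteps

variable {Ω : Type*} [MeasurableSpace Ω] {X : ℕ → Ω → ℝ} {μ : Measure Ω}

lemma indepFun_adicVariation (hX : IsSymmetricSteps X μ) (hB : B ≠ 0) (k : ℕ) {x y : ℕ}
    (hxy : x ≠ y) : IndepFun (fun ω => adicVariation B (sqIncrement fun i => X i ω) k x)
      (fun ω => adicVariation B (sqIncrement fun i => X i ω) k y) μ := by
  let block (z : ℕ) : Finset ℕ := Finset.Ico (B ^ k * z) (B ^ k * (z + 1))
  let extend (z : ℕ) (v : block z → ℝ) (j : ℕ) : ℝ := if hj : j ∈ block z then v ⟨j, hj⟩ else 0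
  have hdisj : Disjoint (block x) (block y) := by
    refine Finset.disjoint_left.2 fun j hjx hjy => hxy ?_
    simp only [block, Finset.mem_Ico, mul_comm (B ^ k)] at hjx hjy
    rw [← Nat.div_eq_of_lt_le hjx.1 hjx.2, Nat.div_eq_of_lt_le hjy.1 hjy.2]
  have hmeas (z : ℕ) :
      Measurable fun v : block z → ℝ => adicVariation B (sqIncrement (extend z v)) k z := by
    refine (measurable_adicVariation_sqIncrement B k z).comp (measurable_pi_lambda _ fun j => ?_)
    dsimp only [extend]
    split_ifs <;> fun_prop
  have hextend (z : ℕ) (ω : Ω) :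
      adicVariation B (sqIncrement (extend z fun i => X i ω)) k z =
        adicVariation B (sqIncrement fun i => X i ω) k z := by
    refine adicVariation_congr hB fun s t hs _ ht => ?_
    rw [sqIncrement, sqIncrement]
    congr 1
    refine Finset.sum_congr rfl fun j hj => dif_pos ?_
    exact Finset.Ico_subset_Ico hs ht hj
  simpa only [Function.comp_def, hextend] using
    (hX.indep.indepFun_finset (block x) (block y) hdisj hX.measurable).comp (hmeas x) (hmeas y)

lemma exists_half_le_measure_adicVariation [IsProbabilityMeasure μ] (hX : IsSymmetricSteps X μ)
    (hB : B ≠ 0) : ∃ k, ∀ᶠ N : ℕ in Filter.atTop, 1 / 2 ≤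
      μ {ω | (B : ℝ) / 64 * (B ^ k * N) ≤
        ∑ x ∈ Finset.range N, adicVariation B (sqIncrement fun i => X i ω) k x} := by
  obtain ⟨k, hk⟩ := hX.exists_le_integral_adicVariation hB
  have : (0 : ℝ) < B := by positivity
  set m : ℝ := B / 32 * B ^ k
  set K : ℝ := (B ^ k) ^ 2 * B ^ k
  have hm : 0 < m := by positivity
  refine ⟨k, ?_⟩
  filter_upwards [Filter.eventually_ne_atTop 0,
    Filter.eventually_ge_atTop ⌈2 * K ^ 2 / m ^ 2⌉₊] with N hN hNK
  have hNK' : 2 * K ^ 2 ≤ m ^ 2 * N := (div_le_iff₀' (by positivity)).1 (Nat.ceil_le.1 hNK)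
  have hhalf := half_le_measure_of_pairwise_indepFun hm
    (fun x => hX.measurable_adicVariation B k x)
    (fun x ω => ⟨adicVariation_nonneg hB (sqIncrement_nonneg _) k x,
      adicVariation_sqIncrement_le hB (hX.abs_le_one · ω) k x⟩)
    (fun x y hxy => hX.indepFun_adicVariation hB k hxy) hk hN hNK'
  convert hhalf using 5
  simp only [m]
  ring

end IsSymmetricSteps

end LawOfLargeNumbers

section CircleSteps

open ProbabilityTheory AddCircle

/-- The function `cos (2 π t)` on the unit circle. -/
noncomputable def circleCos (t : UnitAddCircle) : ℝ :=
  (fourier 1 t : ℂ).re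

@[fun_prop]
lemma continuous_circleCos : Continuous circleCos :=
  Complex.continuous_re.comp (fourier 1).continuous

lemma abs_circleCos_le_one (t : UnitAddCircle) : |circleCos t| ≤ 1 :=
  (Complex.abs_re_le_norm _).trans (by simp [fourier_apply, Circle.norm_coe])

lemma circleCos_add_half (t : UnitAddCircle) :
    circleCos (t + ((1 / 2 : ℝ) : UnitAddCircle)) = -circleCos t := by
  have := fourier_add_half_inv_index (T := (1 : ℝ)) (n := 1) one_ne_zero one_pos t
  rw [Int.cast_one, div_one] at this
  rw [circleCos, this, Complex.neg_re, circleCos]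

lemma circleCos_sq (t : UnitAddCircle) :
    circleCos t ^ 2 = (1 + (fourier 2 t : ℂ).re) / 2 := by
  have hnorm : Complex.normSq (fourier 1 t : ℂ) = 1 := by
    simp [Complex.normSq_eq_norm_sq, fourier_apply, Circle.norm_coe]
  rw [Complex.normSq_apply] at hnorm
  rw [show (2 : ℤ) = 1 + 1 from rfl, fourier_add, Complex.mul_re, circleCos]
  linarith

lemma integral_circleCos_sq : ∫ t, circleCos t ^ 2 ∂(haarAddCircle (T := (1 : ℝ))) = 1 / 2 := by
  have hint : Integrable (fourier 2 : UnitAddCircle → ℂ) haarAddCircle :=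
    (fourier 2).continuous.integrable_of_hasCompactSupport (.of_compactSpace _)
  have hre : Integrable (fun t : UnitAddCircle => (fourier 2 t : ℂ).re) haarAddCircle := hint.re
  have hzero : ∫ t, (fourier 2 t : ℂ).re ∂(haarAddCircle (T := (1 : ℝ))) = 0 := by
    refine (integral_re hint).trans ?_
    rw [integral_fourier, if_neg two_ne_zero, map_zero]
  simp_rw [circleCos_sq]
  rw [integral_div, integral_add (integrable_const 1) hre, hzero]
  simp

/-- The product of the normalised Haar measures on the infinite torus. -/
noncomputable abbrev infiniteTorusMeasure : Measure (UnitAddTorus ℕ) :=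
  Measure.infinitePi fun _ => haarAddCircle

lemma isSymmetricSteps_circleCos :
    IsSymmetricSteps (fun i (θ : UnitAddTorus ℕ) => circleCos (θ i)) infiniteTorusMeasure where
  measurable i := by fun_prop
  indep := iIndepFun_infinitePi fun _ => continuous_circleCos.measurable
  identDistrib_neg i := by
    have heval := measurePreserving_eval_infinitePi
      (fun _ : ℕ => haarAddCircle (T := (1 : ℝ))) i
    have hshift := (measurePreserving_add_right (haarAddCircle (T := (1 : ℝ)))
      ((1 / 2 : ℝ) : UnitAddCircle)).comp heval
    have : IdentDistrib (fun θ : UnitAddTorus ℕ => θ i)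
        (fun θ => θ i + ((1 / 2 : ℝ) : UnitAddCircle)) infiniteTorusMeasure
        infiniteTorusMeasure :=
      ⟨heval.measurable.aemeasurable, hshift.measurable.aemeasurable,
        heval.map_eq.trans hshift.map_eq.symm⟩
    simpa only [Function.comp_def, circleCos_add_half] using
      this.comp continuous_circleCos.measurable
  abs_le_one i θ := abs_circleCos_le_one (θ i)
  half_le_integral_sq i := by
    have heval := measurePreserving_eval_infinitePi
      (fun _ : ℕ => haarAddCircle (T := (1 : ℝ))) i
    rw [← integral_circleCos_sq, ← heval.map_eq,
      integral_map heval.measurable.aemeasurable (by fun_prop)]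

lemma measurePreserving_add_left_infiniteTorusMeasure (α : UnitAddTorus ℕ) :
    MeasurePreserving (α + ·) infiniteTorusMeasure infiniteTorusMeasure := by
  refine ⟨measurable_const_add α, ?_⟩
  have := Measure.infinitePi_map_pi (fun _ : ℕ => haarAddCircle (T := (1 : ℝ)))
    (fun i => measurable_const_add (α i))
  simp only [map_add_left_eq_self] at this
  exact this

end CircleSteps

section Linearization

lemma norm_prod_one_add_sub_one_sub_sum_le {ι R : Type*} [NormedCommRing R] [NormOneClass R]
    (s : Finset ι) (z : ι → R) :
    ‖∏ i ∈ s, (1 + z i) - 1 - ∑ i ∈ s, z i‖ ≤ Real.exp (∑ i ∈ s, ‖z i‖) - 1 - ∑ i ∈ s, ‖z i‖ := by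
  induction s using Finset.cons_induction with
  | empty => simp
  | cons a s ha ih =>
    rw [Finset.prod_cons, Finset.sum_cons, Finset.sum_cons]
    set A := ∑ i ∈ s, ‖z i‖
    calc ‖(1 + z a) * ∏ i ∈ s, (1 + z i) - 1 - (z a + ∑ i ∈ s, z i)‖
        = ‖(∏ i ∈ s, (1 + z i) - 1 - ∑ i ∈ s, z i) + z a * (∏ i ∈ s, (1 + z i) - 1)‖ := by
          congr 1
          ring
      _ ≤ (Real.exp A - 1 - A) + ‖z a‖ * (Real.exp A - 1) := by
          refine (norm_add_le _ _).trans (add_le_add ih ((norm_mul_le _ _).trans ?_))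
          gcongr
          exact s.norm_prod_one_add_sub_one_le z
      _ = (‖z a‖ + 1) * Real.exp A - 1 - (‖z a‖ + A) := by ring
      _ ≤ Real.exp ‖z a‖ * Real.exp A - 1 - (‖z a‖ + A) := by
          gcongr
          exact Real.add_one_le_exp _
      _ = Real.exp (‖z a‖ + A) - 1 - (‖z a‖ + A) := by rw [Real.exp_add]

open Complex

variable {δ : ℝ} {u : ℕ → ℝ}

lemma one_le_norm_one_add_mul_I (x : ℝ) : 1 ≤ ‖1 + (x : ℂ) * I‖ := by
  simpa using abs_re_le_norm (1 + (x : ℂ) * I)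

lemma mul_abs_sum_le_norm_prod_sub_one_add (hδ : 0 ≤ δ) (hu : ∀ i, |u i| ≤ 1) {s : Finset ℕ}
    {n : ℝ} (hn : s.card ≤ n) (hδn : n * δ ≤ 1) :
    δ * |∑ i ∈ s, u i| ≤ ‖∏ i ∈ s, (1 + (δ * u i : ℝ) * I) - 1‖ + (n * δ) ^ 2 := by
  set z : ℕ → ℂ := fun i => (δ * u i : ℝ) * I
  have hz : ∑ i ∈ s, ‖z i‖ ≤ n * δ := by
    have hzi (i : ℕ) : ‖z i‖ ≤ δ := by
      simpa [z, abs_of_nonneg hδ] using mul_le_of_le_one_right hδ (hu i)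
    refine (Finset.sum_le_card_nsmul s _ δ fun i _ => hzi i).trans ?_
    rw [nsmul_eq_mul]
    gcongr
  have hz0 : 0 ≤ ∑ i ∈ s, ‖z i‖ := Finset.sum_nonneg fun i _ => norm_nonneg _
  have hlinear : ‖∏ i ∈ s, (1 + z i) - 1 - ∑ i ∈ s, z i‖ ≤ (n * δ) ^ 2 := by
    refine (norm_prod_one_add_sub_one_sub_sum_le s z).trans ?_
    refine (le_abs_self _).trans ((Real.abs_exp_sub_one_sub_id_le ?_).trans (by gcongr))
    exact (abs_of_nonneg hz0).trans_le (hz.trans hδn)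
  have hsum : ‖∑ i ∈ s, z i‖ = δ * |∑ i ∈ s, u i| := by
    rw [← Finset.sum_mul, ← ofReal_sum, ← Finset.mul_sum, norm_mul, norm_I, mul_one, norm_real,
      norm_mul, Real.norm_of_nonneg hδ, Real.norm_eq_abs]
  rw [← hsum]
  linarith [norm_sub_norm_le (∑ i ∈ s, z i) (∏ i ∈ s, (1 + z i) - 1),
    norm_sub_rev (∑ i ∈ s, z i) (∏ i ∈ s, (1 + z i) - 1)]

lemma norm_prod_Ico_sub_one_le_norm_sub {s t J : ℕ} (hst : s ≤ t) (htJ : t ≤ J) :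
    ‖∏ i ∈ Finset.Ico s t, (1 + (u i : ℂ) * I) - 1‖ ≤
      ‖∏ i ∈ Finset.Ico s J, (1 + (u i : ℂ) * I) - ∏ i ∈ Finset.Ico t J, (1 + (u i : ℂ) * I)‖ := by
  rw [← Finset.prod_Ico_consecutive _ hst htJ, ← sub_one_mul, norm_mul]
  refine le_mul_of_one_le_right (norm_nonneg _) ?_
  rw [norm_prod]
  exact Finset.one_le_prod fun i _ => one_le_norm_one_add_mul_I (u i)

lemma mul_sqIncrement_sub_le_norm_sub_sq (hδ : 0 ≤ δ) (hu : ∀ i, |u i| ≤ 1) {J : ℕ} {n : ℝ}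
    (hδn : n * δ ≤ 1) {a : ℕ → ℂ} (ha : ∀ j ≤ J,
      ‖a j - ∏ i ∈ Finset.Ico j J, (1 + (δ * u i : ℝ) * I)‖ ≤ (n * δ) ^ 2 / 2)
    {s t : ℕ} (hst : s ≤ t) (htJ : t ≤ J) (hn : (t - s : ℕ) ≤ n) :
    δ ^ 2 / 2 * sqIncrement u s t - 4 * (n * δ) ^ 4 ≤ ‖a t - a s‖ ^ 2 := by
  set M : ℕ → ℂ := fun j => ∏ i ∈ Finset.Ico j J, (1 + (δ * u i : ℝ) * I)
  have hincrement : δ * |∑ i ∈ Finset.Ico s t, u i| ≤ ‖M s - M t‖ + (n * δ) ^ 2 :=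
    (mul_abs_sum_le_norm_prod_sub_one_add hδ hu (by rwa [Nat.card_Ico]) hδn).trans <|
      add_le_add_left (norm_prod_Ico_sub_one_le_norm_sub hst htJ) _
  have htriangle : ‖M s - M t‖ ≤ ‖a t - a s‖ + (n * δ) ^ 2 := by
    calc ‖M s - M t‖ = ‖(a t - M t) - (a s - M s) - (a t - a s)‖ := by
          congr 1
          ring
      _ ≤ ‖a t - M t‖ + ‖a s - M s‖ + ‖a t - a s‖ :=
        (norm_sub_le _ _).trans (add_le_add_left (norm_sub_le _ _) _)
      _ ≤ _ := by linarith [ha t htJ, ha s (hst.trans htJ)]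
  have hle : δ * |∑ i ∈ Finset.Ico s t, u i| ≤ ‖a t - a s‖ + 2 * (n * δ) ^ 2 := by linarith
  have hsq := pow_le_pow_left₀ (by positivity) hle 2
  rw [mul_pow, sq_abs] at hsq
  rw [sqIncrement]
  nlinarith [sq_nonneg (‖a t - a s‖ - 2 * (n * δ) ^ 2)]

section Scales

variable {n N : ℝ}

lemma cube_mul_le_one (hn : 1 ≤ n) (hN : 4 * n ^ 3 ≤ N) (hδN : δ ^ 2 * (n * N) = 1) :
    4 * n ^ 3 * (δ ^ 2 * n) ≤ 1 := by
  calc 4 * n ^ 3 * (δ ^ 2 * n) ≤ N * (δ ^ 2 * n) := by gcongr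
    _ = 1 := by rw [← hδN]; ring

lemma mul_le_one_of_cube_le (hn : 1 ≤ n) (hN : 4 * n ^ 3 ≤ N) (hδN : δ ^ 2 * (n * N) = 1) :
    n * δ ≤ 1 := by
  refine le_of_sq_le_sq ?_ zero_le_one
  calc (n * δ) ^ 2 = n * (δ ^ 2 * n) := by ring
    _ ≤ 4 * n ^ 3 * (δ ^ 2 * n) := by
      refine mul_le_mul_of_nonneg_right ?_ (by positivity)
      linarith [le_self_pow₀ hn three_ne_zero, pow_nonneg (zero_le_one.trans hn) 3]
    _ ≤ 1 ^ 2 := (cube_mul_le_one hn hN hδN).trans_eq (one_pow 2).symm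

lemma mul_error_le_one_of_cube_le (hn : 1 ≤ n) (hN : 4 * n ^ 3 ≤ N)
    (hδN : δ ^ 2 * (n * N) = 1) : N * (4 * (n * δ) ^ 4 * n) ≤ 1 := by
  calc N * (4 * (n * δ) ^ 4 * n) = δ ^ 2 * (n * N) * (4 * n ^ 3 * (δ ^ 2 * n)) := by ring
    _ ≤ 1 := by
      rw [hδN, one_mul]
      exact cube_mul_le_one hn hN hδN

end Scales

theorem exists_monotone_le_sum_norm_sub_sq {B : ℕ} (hB : B ≠ 0) {k N : ℕ}
    (hN : 4 * (B ^ k) ^ 3 ≤ N) (hδ : 0 ≤ δ) (hδN : δ ^ 2 * (B ^ k * N) = 1)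
    (hu : ∀ i, |u i| ≤ 1) {a : ℕ → ℂ} (ha : ∀ j ≤ B ^ k * N,
      ‖a j - ∏ i ∈ Finset.Ico j (B ^ k * N), (1 + (δ * u i : ℝ) * I)‖ ≤ (B ^ k * δ) ^ 2 / 2)
    (hvar : (B : ℝ) / 64 * (B ^ k * N) ≤
      ∑ x ∈ Finset.range N, adicVariation B (sqIncrement u) k x) :
    ∃ φ : ℕ → ℕ, Monotone φ ∧ (B : ℝ) / 128 - 1 ≤
      ∑ j ∈ Finset.range (B ^ k * N), ‖a (φ (j + 1)) - a (φ j)‖ ^ 2 := by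
  have hn : (1 : ℝ) ≤ B ^ k := one_le_pow₀ (by exact_mod_cast Nat.one_le_iff_ne_zero.2 hB)
  have hNcast : 4 * ((B : ℝ) ^ k) ^ 3 ≤ N := by exact_mod_cast hN
  obtain ⟨φ, hφ, -, hφvar⟩ := exists_monotone_adicVariation_le_sum
    (g := fun s t => ‖a t - a s‖ ^ 2) hB (fun _ _ => by positivity) k
  refine ⟨φ, hφ, ?_⟩
  set n : ℝ := B ^ k with hn_def
  have hδn : n * δ ≤ 1 := mul_le_one_of_cube_le hn hNcast hδN
  have hblock : ∀ x ∈ Finset.range N,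
      δ ^ 2 / 2 * adicVariation B (sqIncrement u) k x - 4 * (n * δ) ^ 4 * n ≤
        ∑ j ∈ Finset.Ico (B ^ k * x) (B ^ k * (x + 1)), ‖a (φ (j + 1)) - a (φ j)‖ ^ 2 := by
    intro x hx
    refine (mul_adicVariation_sub_le hB (by positivity) (by positivity)
      fun s t hs hst ht => ?_).trans (hφvar x)
    refine mul_sqIncrement_sub_le_norm_sub_sq hδ hu hδn ha hst
      (ht.trans (Nat.mul_le_mul_left _ (Finset.mem_range.1 hx))) ?_
    have : t - s ≤ B ^ k := by rw [mul_add] at ht; omega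
    rw [hn_def]
    exact_mod_cast this
  have herror : N * (4 * (n * δ) ^ 4 * n) ≤ 1 := mul_error_le_one_of_cube_le hn hNcast hδN
  calc (B : ℝ) / 128 - 1 ≤ δ ^ 2 / 2 * (B / 64 * (n * N)) - N * (4 * (n * δ) ^ 4 * n) := by
        linear_combination -B / 128 * hδN + herror
    _ ≤ ∑ x ∈ Finset.range N, (δ ^ 2 / 2 * adicVariation B (sqIncrement u) k x -
          4 * (n * δ) ^ 4 * n) := by
        rw [Finset.sum_sub_distrib, ← Finset.mul_sum, Finset.sum_const, Finset.card_range,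
          nsmul_eq_mul]
        gcongr
    _ ≤ _ := Finset.sum_le_sum hblock
    _ = _ := by
        simpa using sum_Ico_sum_Ico_mul (B ^ k) (fun j => ‖a (φ (j + 1)) - a (φ j)‖ ^ 2)
          N.zero_le

end Linearization

section RotationVariation

open Filter Topology AddCircle

/-- The factor `1 + i δ cos (2 π t)` of the Riesz products. -/
noncomputable def rieszFactor (δ : ℝ) : C(UnitAddCircle, ℂ) :=
  ⟨fun t => 1 + (δ * circleCos t : ℝ) * Complex.I, by fun_prop⟩

lemma integral_rieszFactor (δ : ℝ) : ∫ t, rieszFactor δ t ∂haarAddCircle = 1 := by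
  have hcos : ∫ t, circleCos t ∂(haarAddCircle (T := (1 : ℝ))) = 0 :=
    integral_eq_zero_of_add_right_eq_neg circleCos_add_half
  have hint : Integrable (fun t => δ * circleCos t) (haarAddCircle (T := (1 : ℝ))) :=
    (continuous_circleCos.const_mul δ).integrable_of_hasCompactSupport (.of_compactSpace _)
  simpa [integral_const_mul, hcos, rieszFactor] using
    integral_ofReal_add_ofReal_mul_I (integrable_const 1) hint

variable {P : Polynomial ℤ} {L : ℕ → ℕ} {B : ℕ}

theorem exists_rotation_le_sum_norm_sub_sq (hL : ∀ᶠ n in atTop, L n ≠ 0)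
    (hweyl : ∀ᵐ β ∂(haarAddCircle (T := (1 : ℝ))),
      Tendsto (fun n => weylSum P (L n) β) atTop (𝓝 0)) (hB : B ≠ 0) :
    ∃ (α : UnitAddTorus ℕ) (F : UnitAddTorus ℕ → ℂ) (S : Set (UnitAddTorus ℕ)) (J : ℕ),
      Continuous F ∧ (∀ θ, ‖F θ‖ ≤ 2) ∧ MeasurableSet S ∧ 1 / 2 ≤ infiniteTorusMeasure S ∧
      ∀ θ ∈ S, ∃ ψ : ℕ → ℕ, Monotone ψ ∧ (B : ℝ) / 128 - 1 ≤ ∑ j ∈ Finset.range J,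
        ‖orbitAverage P α (L (ψ (j + 1))) F θ - orbitAverage P α (L (ψ j)) F θ‖ ^ 2 := by
  obtain ⟨k, hk⟩ := isSymmetricSteps_circleCos.exists_half_le_measure_adicVariation hB
  obtain ⟨N, ⟨hS, hN⟩, hN0⟩ :=
    ((hk.and (eventually_ge_atTop (4 * (B ^ k) ^ 3))).and (eventually_ne_atTop 0)).exists
  have hJ : (0 : ℝ) < B ^ k * N := by positivity
  set δ : ℝ := (√(B ^ k * N))⁻¹
  have hδ : 0 < δ := by positivity
  have hδJ : δ ^ 2 * (B ^ k * N) = 1 := by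
    rw [inv_pow, Real.sq_sqrt hJ.le, inv_mul_cancel₀ hJ.ne']
  obtain ⟨α, M, hM, -, happrox⟩ := exists_frequencies_of_weylSum_tendsto_zero hL hweyl
    (integral_rieszFactor δ) (B ^ k * N) (ε := (B ^ k * δ) ^ 2 / 2) (by positivity)
  refine ⟨α, coordProd (rieszFactor δ) (Finset.range (B ^ k * N)), _, B ^ k * N,
    by unfold coordProd; fun_prop, fun θ => ?_, ?_, hS, fun θ hθ => ?_⟩
  · exact norm_prod_one_add_mul_I_le (fun i _ => abs_circleCos_le_one (θ i))
      (by simp [hδJ])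
  · exact measurableSet_le measurable_const
      (Finset.measurable_fun_sum _ fun x _ =>
        isSymmetricSteps_circleCos.measurable_adicVariation B k x)
  · obtain ⟨φ, hφ, hvar⟩ := exists_monotone_le_sum_norm_sub_sq hB hN hδ.le hδJ
      (fun i => abs_circleCos_le_one (θ i)) (fun j hj => happrox j hj θ) hθ
    exact ⟨M ∘ φ, hM.comp hφ, hvar⟩

end RotationVariation

section Variation

variable {ι : Type*} [LinearOrder ι] {r s : ℝ} {I : Set ι}

lemma ennreal_rpow_sum_le_rpow_sum {κ : Type*} (S : Finset κ) (f : κ → ℝ≥0∞) (hr : 0 < r)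
    (hrs : r ≤ s) : (∑ i ∈ S, f i ^ s) ^ (1 / s) ≤ (∑ i ∈ S, f i ^ r) ^ (1 / r) := by
  have hs : 0 < s := hr.trans_le hrs
  have hcancel {x : ℝ} (hx : 0 < x) (y : ℝ≥0∞) : (y ^ (1 / x)) ^ x = y := by
    rw [← ENNReal.rpow_mul, one_div_mul_cancel hx.ne', ENNReal.rpow_one]
  induction S using Finset.cons_induction with
  | empty => simp [hr, hs]
  | cons a S ha ih =>
    rw [Finset.sum_cons, Finset.sum_cons]
    set b := (∑ i ∈ S, f i ^ s) ^ (1 / s)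
    set d := (∑ i ∈ S, f i ^ r) ^ (1 / r)
    calc (f a ^ s + ∑ i ∈ S, f i ^ s) ^ (1 / s) = (f a ^ s + b ^ s) ^ (1 / s) := by rw [hcancel hs]
      _ ≤ (f a ^ s + d ^ s) ^ (1 / s) := by gcongr
      _ ≤ (f a ^ r + d ^ r) ^ (1 / r) := ENNReal.rpow_add_rpow_le _ _ hr hrs
      _ = _ := by rw [hcancel hr]

lemma rVariation_antitone_exponent (hr : 0 < r) (hrs : r ≤ s) (I : Set ι) (a : ι → ℂ) :
    rVariation s I a ≤ rVariation r I a := by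
  unfold rVariation
  gcongr
  exact ennreal_rpow_sum_le_rpow_sum _ _ hr hrs

lemma rpow_sum_le_rVariation (hr : 0 < r) {a : ι → ℂ} {t : ℕ → ι} (ht : Monotone t)
    (htI : ∀ j, t j ∈ I) (J : ℕ) :
    (∑ j ∈ Finset.range J, ‖a (t (j + 1)) - a (t j)‖ₑ ^ r) ^ (1 / r) ≤ rVariation r I a := by
  rcases Nat.eq_zero_or_pos J with rfl | hJ
  · simp [hr]
  · rw [Finset.sum_range]
    exact le_iSup₂_of_le J hJ <| le_iSup₂_of_le (fun j => t j)
      (fun i j hij => ht (by exact_mod_cast hij)) <| le_iSup_of_le (fun j => htI j) le_rfl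

lemma ofReal_le_rVariation_two {a : ι → ℂ} {t : ℕ → ι} (ht : Monotone t) (htI : ∀ j, t j ∈ I)
    {J : ℕ} {c : ℝ} (hc : 0 ≤ c)
    (hsum : c ^ 2 ≤ ∑ j ∈ Finset.range J, ‖a (t (j + 1)) - a (t j)‖ ^ 2) :
    ENNReal.ofReal c ≤ rVariation 2 I a := by
  refine le_trans ?_ (rpow_sum_le_rVariation two_pos ht htI J)
  rw [one_div, ENNReal.le_rpow_inv_iff two_pos, ENNReal.ofReal_rpow_of_nonneg hc zero_le_two,
    Real.rpow_two]
  refine (ENNReal.ofReal_le_ofReal hsum).trans_eq ?_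
  rw [ENNReal.ofReal_sum_of_nonneg fun _ _ => by positivity]
  simp_rw [ENNReal.ofReal_pow (norm_nonneg _), ofReal_norm, ENNReal.rpow_two]

lemma exists_monotone_mem_tendsto_atTop {N : ι → ℝ} (hN : Monotone N)
    (hI : ¬ BddAbove (N '' I)) : ∃ u : ℕ → ι, Monotone u ∧ (∀ n, u n ∈ I) ∧
      Filter.Tendsto (N ∘ u) Filter.atTop Filter.atTop := by
  have hlarge (n : ℕ) : ∃ t ∈ I, (n : ℝ) < N t := by
    simpa using not_bddAbove_iff.1 hI n
  choose v hvI hv using hlarge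
  have hvN : Filter.Tendsto (N ∘ v) Filter.atTop Filter.atTop :=
    Filter.tendsto_atTop_mono (fun n => (hv n).le) tendsto_natCast_atTop_atTop
  obtain ⟨φ, hφ, hmono⟩ := Filter.strictMono_subseq_of_tendsto_atTop hvN
  have hvφ : StrictMono (v ∘ φ) := fun i j hij => hN.reflect_lt (hmono hij)
  exact ⟨v ∘ φ, hvφ.monotone, fun n => hvI _, hvN.comp hφ.tendsto_atTop⟩

lemma mul_rpow_le_eLpNorm_of_forall_mem_le {Ω : Type*} [MeasurableSpace Ω] {μ : Measure Ω}
    {S : Set Ω} (hS : MeasurableSet S) {m c p : ℝ≥0∞} (hm : 0 < m) (hmS : m ≤ μ S) (hp : 0 < p)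
    {g : Ω → ℝ≥0∞} (hg : ∀ ω ∈ S, c ≤ g ω) : c * m ^ (1 / p.toReal) ≤ eLpNorm g p μ := by
  calc c * m ^ (1 / p.toReal) ≤ c * μ S ^ (1 / p.toReal) := by gcongr
    _ = eLpNorm (S.indicator fun _ => c) p μ := by
      rw [eLpNorm_indicator_const' hS (hm.trans_le hmS).ne' hp.ne', enorm_eq_self]
    _ ≤ eLpNorm g p μ := by
      refine eLpNorm_mono_enorm fun ω => ?_
      rw [enorm_eq_self, enorm_eq_self]
      exact Set.indicator_le hg ω

end Variation

section UnboundedVariation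

open Filter Topology

lemma addLeft_zpow_apply {G : Type*} [AddCommGroup G] (α x : G) (z : ℤ) :
    ((Equiv.addLeft α : Equiv.Perm G) ^ z) x = z • α + x := by
  have hinv (y : G) : (Equiv.addLeft α : Equiv.Perm G)⁻¹ y = -α + y := rfl
  induction z using Int.induction_on generalizing x with
  | zero => simp
  | succ n ih =>
    rw [zpow_add_one, Equiv.Perm.mul_apply, ih, Equiv.coe_addLeft, add_smul, one_smul, add_assoc]
  | pred n ih =>
    rw [zpow_sub_one, Equiv.Perm.mul_apply, ih, hinv, sub_smul, one_smul, sub_eq_add_neg,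
      add_assoc]

lemma polyErgodicAverage_addLeft_update {G : Type*} [AddCommGroup G] [MeasurableSpace G]
    [MeasurableAdd G] {k : ℕ} (P : Fin k → Polynomial ℤ) (α : G) (i : Fin k) (F : G → ℂ) (N : ℝ)
    (θ : G) : polyErgodicAverage (MeasurableEquiv.addLeft α) P (Function.update 1 i F) N θ =
      orbitAverage (P i) α ⌊N⌋₊ F θ := by
  rw [polyErgodicAverage, orbitAverage]
  congr 1
  refine Finset.sum_congr rfl fun n _ => ?_
  rw [Fintype.prod_eq_single i fun j hj => by simp [hj], Function.update_self]
  exact congrArg F (addLeft_zpow_apply α θ _)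

variable {ι : Type*} [LinearOrder ι] {N : ι → ℝ} {I : Set ι}

theorem exists_rotation_le_rVariation_two (hN : Monotone N) (hI : ¬ BddAbove (N '' I))
    {P : Polynomial ℤ} (hP : P.natDegree ≠ 0) {c : ℝ} (hc : 0 ≤ c) :
    ∃ (α : UnitAddTorus ℕ) (F : UnitAddTorus ℕ → ℂ) (S : Set (UnitAddTorus ℕ)),
      Measurable F ∧ (∀ θ, ‖F θ‖ ≤ 1) ∧ MeasurableSet S ∧ 1 / 2 ≤ infiniteTorusMeasure S ∧
      ∀ θ ∈ S, ENNReal.ofReal c ≤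
        rVariation 2 I fun t => orbitAverage P α ⌊N t⌋₊ F θ := by
  obtain ⟨u, hu, huI, huN⟩ := exists_monotone_mem_tendsto_atTop hN hI
  have hL : Tendsto (fun n => ⌊N (u n)⌋₊) atTop atTop := tendsto_nat_floor_atTop.comp huN
  obtain ⟨φ, hφ, hweyl⟩ := exists_subseq_weylSum_tendsto_zero_ae hP hL
  obtain ⟨b, hb⟩ := exists_nat_ge (128 * ((2 * c) ^ 2 + 1))
  have hb0 : b ≠ 0 := by
    rintro rfl
    norm_num at hb
    nlinarith
  obtain ⟨α, F, S, J, hF, hF2, hSm, hS, hvar⟩ := exists_rotation_le_sum_norm_sub_sq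
    ((hL.comp hφ.tendsto_atTop).eventually_ne_atTop 0) hweyl hb0
  refine ⟨α, (2⁻¹ : ℂ) • F, S, (hF.const_smul _).measurable, fun θ => ?_, hSm, hS,
    fun θ hθ => ?_⟩
  · rw [Pi.smul_apply, norm_smul, norm_inv, Complex.norm_two]
    linarith [hF2 θ]
  · obtain ⟨ψ, hψ, hsum⟩ := hvar θ hθ
    refine ofReal_le_rVariation_two (J := J) (hu.comp (hφ.monotone.comp hψ))
      (fun _ => huI _) hc ?_
    simp only [Function.comp_apply, orbitAverage_smul, ← mul_sub, norm_mul, mul_pow,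
      ← Finset.mul_sum, norm_inv, Complex.norm_two] at hsum ⊢
    linarith

theorem exists_lt_eLpNorm_rVariation (hN : Monotone N) (hI : ¬ BddAbove (N '' I)) {k : ℕ}
    {P : Fin k → Polynomial ℤ} (hP : ¬ ∀ i, ∃ c : ℤ, P i = Polynomial.C c) {p : ℝ≥0∞} (hp : 0 < p)
    {r : ℝ} (hr : 0 < r) (hr2 : r ≤ 2) {C : ℝ≥0∞} (hC : C ≠ ∞) :
    ∃ (X : Type) (_ : MeasurableSpace X) (μ : Measure X) (T : X ≃ᵐ X) (f : Fin k → X → ℂ),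
      IsProbabilityMeasure μ ∧ MeasurePreserving T μ μ ∧ (∀ i, Measurable (f i)) ∧
      (∀ i x, ‖f i x‖ ≤ 1) ∧
      C < eLpNorm (fun x => rVariation r I fun t => polyErgodicAverage T P f (N t) x) p μ := by
  push Not at hP
  obtain ⟨i, hi⟩ := hP
  have hdeg : (P i).natDegree ≠ 0 := fun h => hi _ (Polynomial.eq_C_of_natDegree_eq_zero h)
  set w : ℝ≥0∞ := (1 / 2) ^ (1 / p.toReal)
  have hw0 : w ≠ 0 := (ENNReal.rpow_pos (by simp) (by simp)).ne'
  have hw : w ≠ ∞ := ENNReal.rpow_ne_top_of_nonneg (by positivity) (by simp)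
  set c : ℝ≥0∞ := (C + 1) / w
  have hc : c ≠ ∞ := ENNReal.div_ne_top (by simpa using hC) hw0
  obtain ⟨α, F, S, hF, hF1, hSm, hS, hvar⟩ :=
    exists_rotation_le_rVariation_two hN hI hdeg c.toReal_nonneg
  refine ⟨UnitAddTorus ℕ, inferInstance, infiniteTorusMeasure, MeasurableEquiv.addLeft α,
    Function.update 1 i F, inferInstance, measurePreserving_add_left_infiniteTorusMeasure α,
    fun j => ?_, fun j x => ?_, ?_⟩
  · rcases eq_or_ne j i with rfl | hj
    · rwa [Function.update_self]
    · rw [Function.update_of_ne hj]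
      exact measurable_one
  · rcases eq_or_ne j i with rfl | hj
    · simpa using hF1 x
    · simp [hj]
  · simp_rw [polyErgodicAverage_addLeft_update]
    calc C < C + 1 := ENNReal.lt_add_right hC one_ne_zero
      _ = c * w := (ENNReal.div_mul_cancel hw0 hw).symm
      _ ≤ _ := mul_rpow_le_eLpNorm_of_forall_mem_le hSm (by simp) hS hp fun θ hθ => by
        rw [← ENNReal.ofReal_toReal hc]
        exact (hvar θ hθ).trans (rVariation_antitone_exponent hr hr2 _ _)

theorem mainTheorem8_general (hN : Monotone N) (hI : ¬ BddAbove (N '' I)) {k : ℕ}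
    {P : Fin k → Polynomial ℤ} (hP : ¬ ∀ i, ∃ c : ℤ, P i = Polynomial.C c) (q : Fin k → ℝ≥0∞)
    {p : ℝ≥0∞} (hp : 0 < p) {r : ℝ} (hr : 0 < r) (hr2 : r ≤ 2) :
    ¬ ∃ C : ℝ, ∀ (X : Type) [MeasurableSpace X] (μ : Measure X) [IsProbabilityMeasure μ]
        (T : X ≃ᵐ X), MeasurePreserving T μ μ →
      ∀ f : Fin k → X → ℂ, (∀ i, MemLp (f i) (q i) μ) →
        eLpNorm (fun x => rVariation r I fun t => polyErgodicAverage T P f (N t) x) p μ ≤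
          ENNReal.ofReal C * ∏ i, eLpNorm (f i) (q i) μ := by
  rintro ⟨C, hC⟩
  obtain ⟨X, _, μ, T, f, _, hT, hf, hf1, hlt⟩ :=
    exists_lt_eLpNorm_rVariation hN hI hP hp hr hr2 (C := ENNReal.ofReal C) ENNReal.ofReal_ne_top
  have hnorm (i : Fin k) : eLpNorm (f i) (q i) μ ≤ 1 := by
    simpa using eLpNorm_le_of_ae_bound (p := q i) (μ := μ) (.of_forall (hf1 i))
  refine hlt.not_ge ((hC X μ T hT f fun i => ?_).trans ?_)
  · exact .of_bound (hf i).aestronglyMeasurable 1 (.of_forall (hf1 i))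
  · exact mul_le_of_le_one_right' (Finset.prod_le_one' fun i _ => hnorm i)

end UnboundedVariation

section IndexSets

lemma not_bddAbove_natCast_image {I : Set ℕ} (hI : I.Infinite) :
    ¬ BddAbove ((fun n : ℕ => (n : ℝ)) '' I) := by
  rw [not_bddAbove_iff]
  intro x
  obtain ⟨n, hn, hxn⟩ := hI.exists_gt ⌊x⌋₊
  exact ⟨n, Set.mem_image_of_mem _ hn, Nat.lt_of_floor_lt hxn⟩

lemma not_bddAbove_range_of_lt_div {l : ℝ} {D : ℕ → ℝ} (hl : 1 < l) (hD0 : 0 < D 0)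
    (hD : ∀ j, l < D (j + 1) / D j) : ¬ BddAbove (Set.range D) := by
  have hpos (j : ℕ) : 0 < D j := by
    induction j with
    | zero => exact hD0
    | succ j ih => exact (div_pos_iff_of_pos_right ih).1 (by linarith [hD j])
  exact Filter.not_bddAbove_of_tendsto_atTop <|
    tendsto_atTop_of_geom_le hD0 hl fun j => ((lt_div_iff₀ (hpos j)).1 (hD j)).le

end IndexSets

theorem mainTheorem8 :
    -- no variational estimate for `0 < r ≤ 2`, uniformly over probability systems
    (∀ (k : ℕ) (P : Fin k → Polynomial ℤ), (¬ ∀ i, ∃ c : ℤ, P i = Polynomial.C c) →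
      ∀ (q : Fin k → ℝ≥0∞) (p : ℝ≥0∞) (r : ℝ), (∀ i, 0 < q i) → 0 < p → 0 < r → r ≤ 2 →
      ∀ I : Set ℕ, (∀ N ∈ I, 1 ≤ N) → I.Infinite →
        ¬ ∃ C : ℝ, 0 < C ∧
          ∀ (X : Type) [MeasurableSpace X] (μ : Measure X) [IsProbabilityMeasure μ]
            (T : X ≃ᵐ X), MeasurePreserving T μ μ →
          ∀ f : Fin k → X → ℂ, (∀ i, MemLp (f i) (q i) μ) →
            eLpNorm (fun x => rVariation r I fun N : ℕ => polyErgodicAverage T P f N x) p μ ≤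
              ENNReal.ofReal C * ∏ i, eLpNorm (f i) (q i) μ) ∧
    -- sharpness of `r > 2` in the bilinear long variational ergodic theorem
    (∀ P : Polynomial ℤ, 2 ≤ P.natDegree →
      ∀ p₁ p₂ p : ℝ≥0∞, 1 < p₁ → p₁ < ∞ → 1 < p₂ → p₂ < ∞ → p₁⁻¹ + p₂⁻¹ = p⁻¹ → p⁻¹ ≤ 1 →
      ∀ r : ℝ, 0 < r → r ≤ 2 →
      ∀ (l : ℝ) (D : ℕ → ℝ), 1 < l → 1 ≤ D 0 → (∀ j, l < D (j + 1) / D j) →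
        ¬ ∃ C : ℝ, 0 < C ∧
          ∀ (X : Type) [MeasurableSpace X] (μ : Measure X) [IsProbabilityMeasure μ]
            (T : X ≃ᵐ X), MeasurePreserving T μ μ →
          ∀ f g : X → ℂ, MemLp f p₁ μ → MemLp g p₂ μ →
            eLpNorm (fun x => rVariationNorm r (Set.range D) fun N : ℝ =>
                polyErgodicAverage T ![Polynomial.X, P] ![f, g] N x) p μ ≤
              ENNReal.ofReal C * (eLpNorm f p₁ μ * eLpNorm g p₂ μ)) := by
  refine ⟨fun k P hP q p r _ hp hr hr2 I _ hI ⟨C, _, hC⟩ =>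
    mainTheorem8_general Nat.mono_cast (not_bddAbove_natCast_image hI) hP q hp hr hr2 ⟨C, hC⟩, ?_⟩
  rintro P - p₁ p₂ p - - - - - hp r hr hr2 l D hl hD0 hD ⟨C, -, hC⟩
  have hI : ¬ BddAbove (id '' Set.range D) := by
    simpa using not_bddAbove_range_of_lt_div hl (one_pos.trans_le hD0) hD
  have hconst : ¬ ∀ i, ∃ c : ℤ, ![Polynomial.X, P] i = Polynomial.C c := fun h => by
    obtain ⟨c, hc⟩ := h 0
    exact Polynomial.X_ne_C c hc
  have hp0 : 0 < p := ENNReal.inv_lt_top.1 (hp.trans_lt ENNReal.one_lt_top)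
  refine mainTheorem8_general monotone_id hI hconst ![p₁, p₂] hp0 hr hr2
    ⟨C, fun X _ μ _ T hT f hf => ?_⟩
  obtain ⟨g, h, rfl⟩ : ∃ g h, f = ![g, h] := ⟨f 0, f 1, List.ofFn_inj.1 rfl⟩
  rw [Fin.prod_univ_two]
  exact (eLpNorm_mono_enorm fun x => le_add_self).trans (hC X μ T hT g h (hf 0) (hf 1))
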